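/- Conventions. An experiment with parameter set $\mathbb R^k\times\Upsilon$ ($\Upsilon$ a real vector space) is a measurable space $(\mathcal X,\mathcal B)$ with a family $\{\mathbb P_{\tau,\eta}:\tau\in\mathbb R^k,\ \eta\in\Upsilon\}$ of probability measures; $d\mathrm P/d\mathrm Q$ denotes the density with respect to $\mathrm Q$ of the $\mathrm Q$-absolutely continuous part of $\mathrm P$. The nuisance subexperiment is $\{\mathbb P_{0,\eta}:\eta\in\Upsilon\}$. Inclusions and equalities between sub-$\sigma$-fields (in minimality, maximality, uniqueness, generation) are understood up to sets that are null under all measures of the experiment considered. In a given experiment, a sub-$\sigma$-field is *sufficient* if each event has a conditional probability given it that is common to all measures of the family, and *minimal sufficient* if moreover it is contained in every sufficient sub-$\sigma$-field; it is *boundedly complete* if each bounded function that is measurable for it and has mean zero under all measures of the family vanishes almost surely under all of them; it is *ancillary* if the probability of each of its events is the same under all measures of the family, and *maximal ancillary* if it is not strictly contained in another ancillary sub-$\sigma$-field. Let $\mathcal E^{(n)}=(\mathcal X^{(n)},\mathcal B^{(n)},\{\mathbb P^{(n)}_{\tau,\eta}\})$, $n\in\mathbb N$, and $\mathcal E=(\mathcal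 X,\mathcal B,\{\mathbb P_{\tau,\eta}\})$ be experiments with parameter set $\mathbb R^k\times\Upsilon$. Random variables $\xi_n$ on $\mathcal X^{(n)}$ converge $\mathcal E^{(n)}$-weakly to a random variable $\xi$ on $\mathcal X$ if, for every finite set $J$ of parameter values, the law under $\mathbb P^{(n)}_{0,0}$ of $\big((d\mathbb P^{(n)}_{\tau,\eta}/d\mathbb P^{(n)}_{0,0})_{(\tau,\eta)\in J},\ \xi_n\big)$ converges weakly to the law under $\mathbb P_{0,0}$ of $\big((d\mathbb P_{\tau,\eta}/d\mathbb P_{0,0})_{(\tau,\eta)\in J},\ \xi\big)$. Sub-$\sigma$-fields $\mathcal A^{(n)}$ of $\mathcal B^{(n)}$ converge $\mathcal E^{(n)}$-weakly to a sub-$\sigma$-field $\mathcal A$ of $\mathcal B$ if every real $\mathcal A$-measurable $\xi$ is the $\mathcal E^{(n)}$-weak limit of some sequence of $\mathcal A^{(n)}$-measurable real random variables $\xi_n$. **Statement.** Suppose that the measures $\mathbb P_{\tau,\eta}$ of $\mathcal E$ are mutually absolutely continuous, that $\mathcal B$ is countably generated, and that (i) the nuisance subexperiment of $\mathcal E$ admits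 a minimal sufficient and boundedly complete $\sigma$-field $\mathcal B_{\rm suff}$, and $\mathcal B^{\ddagger}$ is the unique maximal ancillary $\sigma$-field of that subexperiment such that $\sigma(\mathcal B_{\rm suff}\cup\mathcal B^{\ddagger})=\mathcal B$; (ii) for each $n$, the nuisance subexperiment of $\mathcal E^{(n)}$ admits a minimal sufficient and boundedly complete $\sigma$-field, and $\mathcal B^{\ddagger(n)}$ is a maximal ancillary $\sigma$-field of that subexperiment; (iii) $\mathcal B^{\ddagger(n)}$ converges $\mathcal E^{(n)}$-weakly to $\mathcal B^{\ddagger}$ as $n\to\infty$. Then the restriction $(\mathcal X^{(n)},\mathcal B^{\ddagger(n)},\{\mathbb P^{(n)}_{\tau,\eta}|_{\mathcal B^{\ddagger(n)}}\})$ of $\mathcal E^{(n)}$ to $\mathcal B^{\ddagger(n)}$ converges weakly in the sense of Le Cam to the restriction $(\mathcal X,\mathcal B^{\ddagger},\{\mathbb P_{\tau,\eta}|_{\mathcal B^{\ddagger}}\})$ of $\mathcal E$ to $\mathcal B^{\ddagger}$: for every base point $h_0\in\mathbb R^k\times\Upsilon$ and every finite $J\subset\mathbb R^k\times\Upsilon$,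 the joint law under $\mathbb P^{(n)}_{h_0}$ of the likelihood ratios $\big(d\mathbb P^{(n)}_{h}|_{\mathcal B^{\ddagger(n)}}/d\mathbb P^{(n)}_{h_0}|_{\mathcal B^{\ddagger(n)}}\big)_{h\in J}$ converges weakly, as $n\to\infty$, to the joint law under $\mathbb P_{h_0}$ of $\big(d\mathbb P_{h}|_{\mathcal B^{\ddagger}}/d\mathbb P_{h_0}|_{\mathcal B^{\ddagger}}\big)_{h\in J}$. -/

import Mathlib

open MeasureTheory ProbabilityTheory Filter Topology

universe w w' u v

/-- A statistical experiment `(𝒳, ℬ, {P_h : h ∈ Θ})` with parameter set `Θ`. -/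
structure StatExperiment (Θ : Type w) where
  /-- the observation space -/
  carrier : Type u
  /-- its σ-field -/
  sigma : MeasurableSpace carrier
  /-- the family of distributions -/
  P : Θ → @Measure carrier sigma
  /-- they are probability measures -/
  isProb : ∀ h, IsProbabilityMeasure (P h)

attribute [instance] StatExperiment.sigma StatExperiment.isProb

namespace StatExperiment

variable {Θ : Type w} {Θ' : Type w'}

/-- Subexperiment (reparametrization) along a map of parameter sets. -/
def reparam (E : StatExperiment.{w, u} Θ) (f : Θ' → Θ) : StatExperiment.{w', u} Θ' where
  carrier := E.carrier
  sigma := E.sigma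
  P h := E.P (f h)
  isProb h := E.isProb (f h)

/-- Restriction `(𝒳, A, {P_h|_A})` of an experiment to a sub-σ-field `A`. -/
noncomputable def restrict (E : StatExperiment.{w, u} Θ) (A : MeasurableSpace E.carrier)
    (hA : A ≤ E.sigma) : StatExperiment.{w, u} Θ where
  carrier := E.carrier
  sigma := A
  P h := (E.P h).trim hA
  isProb _ := ⟨by rw [trim_measurableSet_eq hA MeasurableSet.univ]; exact measure_univ⟩

/-- Likelihood ratio `dP_h/dP_{h₀}`: the density with respect to `P_{h₀}` of the part of `P_h`
that is absolutely continuous with respect to `P_{h₀}`. -/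
noncomputable def lr (E : StatExperiment.{w, u} Θ) (h₀ h : Θ) (x : E.carrier) : ℝ :=
  ((E.P h).rnDeriv (E.P h₀) x).toReal

/-- All measures of the experiment are mutually absolutely continuous. -/
def MutuallyAC (E : StatExperiment.{w, u} Θ) : Prop :=
  ∀ h h', E.P h ≪ E.P h'

/-- `A ⊆ C` up to sets that are null under every measure of the experiment. -/
def EssLE (E : StatExperiment.{w, u} Θ) (A C : MeasurableSpace E.carrier) : Prop :=
  ∀ s, MeasurableSet[A] s → ∃ t, MeasurableSet[C] t ∧ ∀ h, E.P h (symmDiff s t) = 0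

/-- `A = C` up to sets that are null under every measure of the experiment. -/
def EssEq (E : StatExperiment.{w, u} Θ) (A C : MeasurableSpace E.carrier) : Prop :=
  E.EssLE A C ∧ E.EssLE C A

/-- The σ-field of the experiment is countably generated, up to null sets. -/
def EssCountablyGenerated (E : StatExperiment.{w, u} Θ) : Prop :=
  ∃ C : MeasurableSpace E.carrier,
    C ≤ E.sigma ∧ @MeasurableSpace.CountablyGenerated E.carrier C ∧ E.EssLE E.sigma C

/-- `F` is a sufficient sub-σ-field: every event has a version of its conditional probability
given `F` that is the same for all measures of the experiment. -/
def IsSufficient (E : StatExperiment.{w, u} Θ) (F : MeasurableSpace E.carrier) : Prop :=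
  F ≤ E.sigma ∧ ∀ s, MeasurableSet[E.sigma] s →
    ∃ g : E.carrier → ℝ, Measurable[F] g ∧ ∀ h, g =ᵐ[E.P h] (E.P h)⟦s | F⟧

/-- `F` is minimal sufficient: sufficient and, up to null sets, contained in every sufficient
sub-σ-field. -/
def IsMinimalSufficient (E : StatExperiment.{w, u} Θ) (F : MeasurableSpace E.carrier) : Prop :=
  E.IsSufficient F ∧ ∀ G, E.IsSufficient G → E.EssLE F G

/-- `F` is a boundedly complete sub-σ-field. -/
def IsBoundedlyComplete (E : StatExperiment.{w, u} Θ) (F : MeasurableSpace E.carrier) : Prop :=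
  F ≤ E.sigma ∧ ∀ g : E.carrier → ℝ, Measurable[F] g → (∃ M : ℝ, ∀ x, |g x| ≤ M) →
    (∀ h, ∫ x, g x ∂(E.P h) = 0) → ∀ h, g =ᵐ[E.P h] 0

/-- `A` is an ancillary sub-σ-field: the probabilities of its events are the same under all
measures of the experiment. -/
def IsAncillary (E : StatExperiment.{w, u} Θ) (A : MeasurableSpace E.carrier) : Prop :=
  A ≤ E.sigma ∧ ∀ s, MeasurableSet[A] s → ∀ h h', E.P h s = E.P h' s

/-- `A` is maximal ancillary (with respect to inclusion up to null sets). -/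
def IsMaximalAncillary (E : StatExperiment.{w, u} Θ) (A : MeasurableSpace E.carrier) : Prop :=
  E.IsAncillary A ∧ ∀ C, E.IsAncillary C → E.EssLE A C → E.EssLE C A

/-- `F` and `A` together generate the σ-field of the experiment, up to null sets. -/
def Generates (E : StatExperiment.{w, u} Θ) (F A : MeasurableSpace E.carrier) : Prop :=
  E.EssEq (F ⊔ A) E.sigma

/-- Weak convergence of experiments in the sense of Le Cam: for every base point `h₀`, the
finite-dimensional distributions under `h₀` of the likelihood ratio processes
`h ↦ dP_h/dP_{h₀}` converge. -/
def WeakConv (En : ℕ → StatExperiment.{w, u} Θ) (E : StatExperiment.{w, v} Θ) : Prop :=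
  ∀ (h₀ : Θ) (J : Finset Θ),
    TendstoInDistribution
      (fun (n : ℕ) (x : (En n).carrier) (h : J) => (En n).lr h₀ h x) atTop
      (fun (x : E.carrier) (h : J) => E.lr h₀ h x)
      (fun n => (En n).P h₀) (E.P h₀)

/-- `ℰ⁽ⁿ⁾`-weak convergence of the random variables `ξn n` to `ξ` (with base point `h₀`):
joint convergence in distribution, under `h₀`, with every finite family of likelihood ratios. -/
def VarWeakConv (En : ℕ → StatExperiment.{w, u} Θ) (E : StatExperiment.{w, v} Θ) (h₀ : Θ)
    (ξn : ∀ n, (En n).carrier → ℝ) (ξ : E.carrier → ℝ) : Prop :=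
  ∀ J : Finset Θ,
    TendstoInDistribution
      (fun (n : ℕ) (x : (En n).carrier) => ((fun h : J => (En n).lr h₀ h x), ξn n x)) atTop
      (fun (x : E.carrier) => ((fun h : J => E.lr h₀ h x), ξ x))
      (fun n => (En n).P h₀) (E.P h₀)

/-- `ℰ⁽ⁿ⁾`-weak convergence of the sub-σ-fields `An n` to the sub-σ-field `A`: every
`A`-measurable variable is the weak limit of a sequence of `An n`-measurable variables. -/
def FieldWeakConv (En : ℕ → StatExperiment.{w, u} Θ) (E : StatExperiment.{w, v} Θ) (h₀ : Θ)
    (An : ∀ n, MeasurableSpace (En n).carrier) (A : MeasurableSpace E.carrier) : Prop :=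
  ∀ ξ : E.carrier → ℝ, Measurable[A] ξ →
    ∃ ξn : ∀ n, (En n).carrier → ℝ, (∀ n, Measurable[An n] (ξn n)) ∧
      VarWeakConv En E h₀ ξn ξ

/-- The nuisance subexperiment `{P_{0,η} : η ∈ Υ}` of an experiment with parameter of interest
`τ ∈ ℝᵏ` and nuisance `η ∈ Υ`. -/
def nuisance {k : ℕ} {Υ : Type w} (E : StatExperiment.{w, u} (EuclideanSpace ℝ (Fin k) × Υ)) :
    StatExperiment.{w, u} Υ :=
  E.reparam fun η => (0, η)

end StatExperiment

/-! Write `ν` for the measure at the base point `(0, 0)`, `F` for the complete sufficient σ-field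
and `A` for the ancillary one. The likelihood ratio of a restriction to `A` is a conditional
expectation given `A`, and conditioning is in general not continuous under weak convergence. The
proof shows that here it is, in three moves.

Density: linear combinations of `(dP_{0,η}/dν) · 1_s` with `s ∈ A` are dense in `L¹(ν)`. If a
bounded `w` annihilates all of them, then `E_ν[w 1_s | F]` has mean zero under every `P_{0,η}`,
because sufficiency makes `dP_{0,η}/dν` measurable for `F`. Bounded completeness makes this
conditional expectation vanish, so `w` integrates to zero over all `r ∩ s` with `r ∈ F`, `s ∈ A`.
These sets generate everything, hence `w = 0`, and Hahn–Banach applies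
(`exists_integral_abs_sub_sum_rnDeriv_lt`).

Projection: by ancillarity `P_{0,η}` and `ν` agree on `A`, so conditioning on `A` replaces
`dP_{0,η}/dν` by `1`. As conditioning contracts `L¹`, an approximation `dP_h/dν ≈ ∑ cᵢ
(dP_{0,ηᵢ}/dν) 1_{sᵢ}` yields `∑ cᵢ 1_{sᵢ}` as an approximation of the restricted likelihood ratio.
Without absolute continuity this persists up to singular masses
(`integral_abs_rnDeriv_trim_sub_sum_le`).

Transfer: the finitely many `sᵢ` are encoded in one `A`-measurable real `ξ`, with `1_{sᵢ} = γᵢ(ξ)`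
for continuous `γᵢ`, and `ξ` is a weak limit of some `ξₙ`. The `L¹` error of the unrestricted
approximation is a continuous functional of likelihood ratios and `ξₙ`. Since the limit measures are
mutually absolutely continuous, the means of the likelihood ratios tend to `1`; this supplies
uniform integrability and removes the singular masses, so the error converges to its limit value
(`exists_approx_lr_restrict`). Hence the restricted likelihood ratios are close in mean to `∑ cᵢ
γᵢ(ξₙ)`, which converges in law to `∑ cᵢ γᵢ(ξ)`. `weakConv_of_base` then passes to arbitrary base
points. -/

section ConvergenceInDistribution

/-! ### Convergence in distribution and convergence of means. -/

variable {S Ω' : Type*} {Ω : ℕ → Type*} {m : ∀ i, MeasurableSpace (Ω i)}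
  {μ : (i : ℕ) → Measure (Ω i)} [∀ i, IsProbabilityMeasure (μ i)]
  {m' : MeasurableSpace Ω'} {μ' : Measure Ω'} [IsProbabilityMeasure μ']
  {mS : MeasurableSpace S} {X : (i : ℕ) → Ω i → S} {Z : Ω' → S}

/-- Convergence in distribution implies convergence of the means of bounded continuous functions. -/
theorem MeasureTheory.TendstoInDistribution.tendsto_integral [TopologicalSpace S] [BorelSpace S]
    (h : TendstoInDistribution X atTop Z μ μ') {g : S → ℝ} (hg : Continuous g) {K : ℝ}
    (hK : ∀ x, |g x| ≤ K) :
    Tendsto (fun n => ∫ ω, g (X n ω) ∂μ n) atTop (𝓝 (∫ ω, g (Z ω) ∂μ')) := by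
  have h1 := (ProbabilityMeasure.tendsto_iff_forall_integral_tendsto.1 h.tendsto)
    (BoundedContinuousFunction.ofNormedAddCommGroup g hg K hK)
  have e1 : ∀ n, ∫ x, g x ∂((μ n).map (X n)) = ∫ ω, g (X n ω) ∂μ n := fun n =>
    integral_map (h.forall_aemeasurable n) hg.measurable.aestronglyMeasurable
  have e2 : ∫ x, g x ∂(μ'.map Z) = ∫ ω, g (Z ω) ∂μ' :=
    integral_map h.aemeasurable_limit hg.measurable.aestronglyMeasurable
  simpa [e1, e2] using h1

/-- To prove convergence in distribution it suffices to test bounded Lipschitz functions. -/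
theorem tendstoInDistribution_of_forall_lipschitz [PseudoEMetricSpace S] [BorelSpace S]
    (hX : ∀ n, AEMeasurable (X n) (μ n)) (hZ : AEMeasurable Z μ')
    (h : ∀ (g : S → ℝ) (K : ℝ) (L : NNReal), (∀ x, |g x| ≤ K) → LipschitzWith L g →
      Tendsto (fun n => ∫ ω, g (X n ω) ∂μ n) atTop (𝓝 (∫ ω, g (Z ω) ∂μ'))) :
    TendstoInDistribution X atTop Z μ μ' := by
  refine ⟨hX, hZ, ?_⟩
  refine tendsto_iff_forall_lipschitz_integral_tendsto.2 ?_
  rintro g ⟨C, hC⟩ ⟨L, hL⟩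
  obtain ⟨K, hK⟩ : ∃ K, ∀ x, |g x| ≤ K := by
    rcases isEmpty_or_nonempty S with hS | ⟨⟨x₀⟩⟩
    · exact ⟨0, fun x => hS.elim x⟩
    · refine ⟨C + |g x₀|, fun x => ?_⟩
      have h1 := hC x x₀
      rw [Real.dist_eq] at h1
      have h2 := abs_add_le (g x - g x₀) (g x₀)
      rw [sub_add_cancel] at h2
      linarith
  have h1 := h g K L hK hL
  have e1 : ∀ n, ∫ x, g x ∂((μ n).map (X n)) = ∫ ω, g (X n ω) ∂μ n := fun n =>
    integral_map (hX n) hL.continuous.measurable.aestronglyMeasurable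
  have e2 : ∫ x, g x ∂(μ'.map Z) = ∫ ω, g (Z ω) ∂μ' :=
    integral_map hZ hL.continuous.measurable.aestronglyMeasurable
  simpa [e1, e2] using h1

/-- Lower semicontinuity of the mean of a nonnegative continuous function. -/
theorem MeasureTheory.TendstoInDistribution.eventually_lt_integral
    [TopologicalSpace S] [BorelSpace S]
    (h : TendstoInDistribution X atTop Z μ μ') {f : S → ℝ} (hf : Continuous f)
    (hf0 : ∀ x, 0 ≤ f x) (hfX : ∀ n, Integrable (fun ω => f (X n ω)) (μ n))
    (hfZ : Integrable (fun ω => f (Z ω)) μ') {c : ℝ} (hc : c < ∫ ω, f (Z ω) ∂μ') :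
    ∀ᶠ n in atTop, c < ∫ ω, f (X n ω) ∂μ n := by
  -- Truncation at a level `K` so high that the truncated limit mean still exceeds `c` reduces the
  -- claim to a bounded test function.
  have hlim : Tendsto (fun K : ℕ => ∫ ω, min (f (Z ω)) K ∂μ') atTop (𝓝 (∫ ω, f (Z ω) ∂μ')) := by
    refine tendsto_integral_of_dominated_convergence (fun ω => f (Z ω)) (fun K => ?_) hfZ
      (fun K => Eventually.of_forall fun ω => ?_) (Eventually.of_forall fun ω => ?_)
    · exact (hfZ.aestronglyMeasurable.aemeasurable.min aemeasurable_const).aestronglyMeasurable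
    · have := hf0 (Z ω)
      rw [Real.norm_eq_abs, abs_of_nonneg (le_min this K.cast_nonneg)]
      exact min_le_left _ _
    · obtain ⟨N, hN⟩ := exists_nat_ge (f (Z ω))
      refine tendsto_const_nhds.congr' ?_
      filter_upwards [eventually_ge_atTop N] with K hK
      exact (min_eq_left (hN.trans (by exact_mod_cast hK))).symm
  obtain ⟨K, hK⟩ := (hlim.eventually_const_lt hc).exists
  have hb : ∀ x, |min (f x) (K : ℝ)| ≤ K := fun x => by
    rw [abs_of_nonneg (le_min (hf0 x) K.cast_nonneg)]
    exact min_le_right _ _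
  have h2 := h.tendsto_integral (hf.min continuous_const) hb
  filter_upwards [h2.eventually_const_lt hK] with n hn
  refine hn.trans_le (integral_mono_of_nonneg ?_ (hfX n) ?_)
  · exact Eventually.of_forall fun ω => le_min (hf0 _) K.cast_nonneg
  · exact Eventually.of_forall fun ω => min_le_left _ _

/-- Convergence of means under convergence in distribution, for a continuous function dominated by
a continuous function whose means converge. -/
theorem MeasureTheory.TendstoInDistribution.tendsto_integral_of_abs_le
    [TopologicalSpace S] [BorelSpace S]
    (h : TendstoInDistribution X atTop Z μ μ') {a G : S → ℝ} (ha : Continuous a)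
    (hG : Continuous G) (hGa : ∀ x, |G x| ≤ a x)
    (haX : ∀ n, Integrable (fun ω => a (X n ω)) (μ n))
    (haZ : Integrable (fun ω => a (Z ω)) μ')
    (hlim : Tendsto (fun n => ∫ ω, a (X n ω) ∂μ n) atTop (𝓝 (∫ ω, a (Z ω) ∂μ'))) :
    Tendsto (fun n => ∫ ω, G (X n ω) ∂μ n) atTop (𝓝 (∫ ω, G (Z ω) ∂μ')) := by
  have hGX : ∀ n, Integrable (fun ω => G (X n ω)) (μ n) := fun n =>
    (haX n).mono' (hG.measurable.comp_aemeasurable (h.forall_aemeasurable n)).aestronglyMeasurable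
      (Eventually.of_forall fun ω => hGa _)
  have hGZ : Integrable (fun ω => G (Z ω)) μ' :=
    haZ.mono' (hG.measurable.comp_aemeasurable h.aemeasurable_limit).aestronglyMeasurable
      (Eventually.of_forall fun ω => hGa _)
  rw [Metric.tendsto_atTop'] at hlim ⊢
  intro ε hε
  obtain ⟨N, hN⟩ := hlim (ε / 2) (by positivity)
  -- Both `a + G` and `a - G` are nonnegative: lower semicontinuity of their means, with convergence
  -- of the means of `a`, bounds the means of `G` from both sides.
  have hp := h.eventually_lt_integral (f := fun x => a x + G x) (ha.add hG)
    (fun x => by linarith [neg_abs_le (G x), hGa x]) (fun n => (haX n).add (hGX n))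
    (haZ.add hGZ) (c := ∫ ω, (a (Z ω) + G (Z ω)) ∂μ' - ε / 2) (by linarith)
  have hm := h.eventually_lt_integral (f := fun x => a x - G x) (ha.sub hG)
    (fun x => by linarith [le_abs_self (G x), hGa x]) (fun n => (haX n).sub (hGX n))
    (haZ.sub hGZ) (c := ∫ ω, (a (Z ω) - G (Z ω)) ∂μ' - ε / 2) (by linarith)
  obtain ⟨N', hN'⟩ := eventually_atTop.1 (hp.and hm)
  refine ⟨max N N', fun n hn => ?_⟩
  have h1 := hN n ((le_max_left _ _).trans_lt hn)
  obtain ⟨h2, h3⟩ := hN' n ((le_max_right _ _).trans hn.le)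
  rw [integral_add haZ hGZ, integral_add (haX n) (hGX n)] at h2
  rw [integral_sub haZ hGZ, integral_sub (haX n) (hGX n)] at h3
  rw [Real.dist_eq, abs_lt] at h1 ⊢
  constructor <;> linarith [h1.1, h1.2]

end ConvergenceInDistribution

/-! ### Densities of absolutely continuous parts and restriction to a sub-σ-field. -/

section LebesgueDecomposition

variable {Ω : Type*} {m m0 : MeasurableSpace Ω} {μ ν : Measure Ω}

theorem isProbabilityMeasure_trim [IsProbabilityMeasure μ] (hm : m ≤ m0) :
    IsProbabilityMeasure (μ.trim hm) :=
  ⟨by rw [trim_measurableSet_eq hm MeasurableSet.univ]; exact measure_univ⟩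

theorem integrable_toReal_rnDeriv_mul_of_abs_le [IsFiniteMeasure μ] {ψ : Ω → ℝ}
    (hψ : Measurable ψ) {K : ℝ} (hK : ∀ x, |ψ x| ≤ K) :
    Integrable (fun x => (μ.rnDeriv ν x).toReal * ψ x) ν :=
  Measure.integrable_toReal_rnDeriv.mul_bdd (c := K) hψ.aestronglyMeasurable
    (Eventually.of_forall hK)

/-- Integrals against `μ` and against its absolutely continuous part differ by at most the mass of
the singular part times a bound of the integrand. -/
theorem abs_integral_sub_integral_rnDeriv_mul_le [IsProbabilityMeasure μ] [IsProbabilityMeasure ν]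
    {ψ : Ω → ℝ} (hψ : Measurable ψ) {K : ℝ} (hK : ∀ x, |ψ x| ≤ K) :
    |∫ x, ψ x ∂μ - ∫ x, (μ.rnDeriv ν x).toReal * ψ x ∂ν| ≤
      K * (1 - ∫ x, (μ.rnDeriv ν x).toReal ∂ν) := by
  have hint : ∀ ρ : Measure Ω, IsFiniteMeasure ρ → Integrable ψ ρ := fun ρ _ =>
    Integrable.of_bound hψ.aestronglyMeasurable K (Eventually.of_forall hK)
  have e1 : ∫ x, ψ x ∂μ = ∫ x, ψ x ∂(μ.singularPart ν) +
      ∫ x, (μ.rnDeriv ν x).toReal * ψ x ∂ν := by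
    conv_lhs => rw [← μ.singularPart_add_rnDeriv ν]
    rw [integral_add_measure (hint _ inferInstance) (hint _ inferInstance),
      integral_withDensity_eq_integral_toReal_smul (Measure.measurable_rnDeriv _ _)
        (Measure.rnDeriv_lt_top _ _)]
    rfl
  rw [e1, add_sub_cancel_right, Measure.integral_toReal_rnDeriv', probReal_univ,
    sub_sub_cancel]
  exact norm_integral_le_of_norm_le_const (μ := μ.singularPart ν) (f := ψ) (Eventually.of_forall hK)

theorem integral_toReal_rnDeriv_le_one [IsProbabilityMeasure μ] [IsProbabilityMeasure ν] :
    ∫ x, (μ.rnDeriv ν x).toReal ∂ν ≤ 1 := by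
  rw [Measure.integral_toReal_rnDeriv', probReal_univ]
  linarith [measureReal_nonneg (μ := μ.singularPart ν) (s := Set.univ)]

/-- The absolutely continuous part can only gain mass under restriction to a sub-σ-field. -/
theorem integral_toReal_rnDeriv_le_trim [IsProbabilityMeasure μ] [IsProbabilityMeasure ν]
    (hm : m ≤ m0) :
    ∫ x, (μ.rnDeriv ν x).toReal ∂ν ≤
      ∫ x, ((μ.trim hm).rnDeriv (ν.trim hm) x).toReal ∂(ν.trim hm) := by
  -- The singular part of the restriction lives on the `ν`-null set `sᶜ`, which the absolutely
  -- continuous part of `μ` does not charge; so its mass is at most that of the singular part of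
  -- `μ`.
  obtain ⟨s, hs, hs1, hs2⟩ := (μ.trim hm).mutuallySingular_singularPart (ν.trim hm)
  have hνs : ν sᶜ = 0 := by rwa [trim_measurableSet_eq hm hs.compl] at hs2
  have e2 : ((μ.trim hm).singularPart (ν.trim hm)).real Set.univ ≤ μ.real sᶜ := by
    rw [← Set.union_compl_self s]
    refine (measureReal_union_le _ _).trans ?_
    rw [measureReal_def, hs1, ENNReal.toReal_zero, zero_add, measureReal_def, measureReal_def]
    refine ENNReal.toReal_mono (measure_ne_top _ _) ?_
    refine ((Measure.singularPart_le _ _) _).trans ?_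
    rw [trim_measurableSet_eq hm hs.compl]
  have e3 : μ.real sᶜ ≤ (μ.singularPart ν).real Set.univ := by
    rw [measureReal_def, measureReal_def]
    refine ENNReal.toReal_mono (measure_ne_top _ _) ?_
    conv_lhs => rw [← μ.singularPart_add_rnDeriv ν]
    rw [Measure.add_apply, withDensity_absolutelyContinuous _ _ hνs, add_zero]
    exact measure_mono (Set.subset_univ _)
  have := isProbabilityMeasure_trim (μ := μ) hm
  rw [Measure.integral_toReal_rnDeriv', Measure.integral_toReal_rnDeriv', probReal_univ (μ := μ),
    probReal_univ (μ := μ.trim hm)]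
  linarith

/-- Chain rule for densities, almost everywhere for the absolutely continuous part of the middle
measure. -/
theorem rnDeriv_mul_rnDeriv_ae_withDensity (μ ν κ : Measure Ω) [IsFiniteMeasure μ]
    [IsFiniteMeasure ν] [IsFiniteMeasure κ] :
    ∀ᵐ x ∂κ, ν.rnDeriv κ x ≠ 0 → μ.rnDeriv ν x * ν.rnDeriv κ x = μ.rnDeriv κ x := by
  rw [← ae_withDensity_iff (Measure.measurable_rnDeriv _ _)]
  set ρ := κ.withDensity (ν.rnDeriv κ) with hρ
  have hρκ : ρ ≪ κ := withDensity_absolutelyContinuous _ _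
  have h1 := Measure.rnDeriv_mul_rnDeriv' (μ := μ) hρκ
  have h2 : ρ.rnDeriv κ =ᵐ[ρ] ν.rnDeriv κ :=
    hρκ (Measure.rnDeriv_withDensity κ (Measure.measurable_rnDeriv _ _))
  -- `ν` is `ρ` plus a measure singular to `ρ`, which does not affect the density `ρ`-almost
  -- everywhere.
  have h3 : μ.rnDeriv ν =ᵐ[ρ] μ.rnDeriv ρ := by
    have hs : ρ ⟂ₘ ν.singularPart κ :=
      ((Measure.mutuallySingular_singularPart ν κ).mono_ac Measure.AbsolutelyContinuous.rfl
        hρκ).symm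
    have := Measure.rnDeriv_add_right_of_mutuallySingular (μ := μ) hs
    rwa [Measure.rnDeriv_add_singularPart] at this
  filter_upwards [h1, h2, h3] with x hx1 hx2 hx3
  rw [hx3, ← hx2, ← hx1, Pi.mul_apply]

/-- If the measures `ρ i` agree with `ν` on the sub-σ-field `m`, then approximating the density of
`μ` by an `m`-measurable combination of the densities of the `ρ i` amounts to approximating the
density of the restriction of `μ` to `m` by the sum of the coefficients. -/
theorem integral_abs_rnDeriv_trim_sub_sum_le [IsProbabilityMeasure μ] [IsProbabilityMeasure ν]
    (hm : m ≤ m0) {ι : Type*} (t : Finset ι) (ρ : ι → Measure Ω)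
    [∀ i, IsProbabilityMeasure (ρ i)] (hρ : ∀ i, ∀ s, MeasurableSet[m] s → ρ i s = ν s)
    (g : ι → Ω → ℝ) (hg : ∀ i, Measurable[m] (g i)) (K : ι → ℝ) (hK : ∀ i x, |g i x| ≤ K i) :
    ∫ x, |((μ.trim hm).rnDeriv (ν.trim hm) x).toReal - ∑ i ∈ t, g i x| ∂(ν.trim hm) ≤
      ∫ x, |(μ.rnDeriv ν x).toReal - ∑ i ∈ t, ((ρ i).rnDeriv ν x).toReal * g i x| ∂ν +
      2 * (1 - ∫ x, (μ.rnDeriv ν x).toReal ∂ν) +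
      ∑ i ∈ t, K i * (1 - ∫ x, ((ρ i).rnDeriv ν x).toReal ∂ν) := by
  have := isProbabilityMeasure_trim (μ := μ) hm
  have := isProbabilityMeasure_trim (μ := ν) hm
  set R : Ω → ℝ := fun x => ((μ.trim hm).rnDeriv (ν.trim hm) x).toReal with hR
  have hRm : Measurable[m] R := (Measure.measurable_rnDeriv _ _).ennreal_toReal
  have hsum : Measurable[m] (fun x => ∑ i ∈ t, g i x) := Finset.measurable_sum t fun i _ => hg i
  have hD : MeasurableSet[m] {x | 0 ≤ R x - ∑ i ∈ t, g i x} :=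
    measurableSet_le (@measurable_const _ _ _ m _) (hRm.sub hsum)
  -- An `m`-measurable sign linearizes the `L¹` norm, so the integrals can be moved between the
  -- restricted and the full measures.
  set ψ : Ω → ℝ := fun x => if 0 ≤ R x - ∑ i ∈ t, g i x then 1 else -1 with hψdef
  have hψ : Measurable[m] ψ := Measurable.ite hD (@measurable_const _ _ _ m _)
    (@measurable_const _ _ _ m _)
  have hψ0 : Measurable ψ := hψ.mono hm le_rfl
  have hψ1 : ∀ x, |ψ x| ≤ 1 := fun x => by
    simp only [hψdef]; split_ifs <;> simp
  have habs : ∀ x, |R x - ∑ i ∈ t, g i x| = R x * ψ x - ∑ i ∈ t, g i x * ψ x := fun x => by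
    rw [← Finset.sum_mul, ← sub_mul]
    simp only [hψdef]
    split_ifs with h
    · rw [abs_of_nonneg h, mul_one]
    · rw [abs_of_neg (not_le.1 h), mul_neg_one]
  have hgψ : ∀ i x, |g i x * ψ x| ≤ K i := fun i x => by
    rw [abs_mul]
    calc |g i x| * |ψ x| ≤ |g i x| * 1 := by gcongr; exact hψ1 x
      _ ≤ K i := by rw [mul_one]; exact hK i x
  have hgψm : ∀ i, Measurable[m] fun x => g i x * ψ x := fun i => (hg i).mul hψ
  have hgψm0 : ∀ i, Measurable fun x => g i x * ψ x := fun i => (hgψm i).mono hm le_rfl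
  have hint : ∀ i, Integrable (fun x => g i x * ψ x) (ν.trim hm) := fun i =>
    Integrable.of_bound (hgψm i).aestronglyMeasurable (K i) (Eventually.of_forall (hgψ i))
  have htrim : ∀ i, (ρ i).trim hm = ν.trim hm := fun i =>
    @Measure.ext _ m _ _ fun s hs => by
      rw [trim_measurableSet_eq hm hs, trim_measurableSet_eq hm hs, hρ i s hs]
  have e1 : ∫ x, |R x - ∑ i ∈ t, g i x| ∂(ν.trim hm) =
      ∫ x, R x * ψ x ∂(ν.trim hm) - ∑ i ∈ t, ∫ x, g i x * ψ x ∂(ρ i) := by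
    simp_rw [habs]
    rw [integral_sub (integrable_toReal_rnDeriv_mul_of_abs_le hψ hψ1)
      (integrable_finsetSum t fun i _ => hint i), integral_finsetSum t fun i _ => hint i]
    congr 1
    refine Finset.sum_congr rfl fun i _ => ?_
    rw [integral_trim hm (hgψm i).stronglyMeasurable, htrim i]
  -- Going from the restricted density to `μ` and back to the full density costs one singular mass
  -- each; by `b3` the first is at most the second, whence the factor `2`.
  have b1 := (abs_le.1 (abs_integral_sub_integral_rnDeriv_mul_le (μ := μ.trim hm)
    (ν := ν.trim hm) hψ hψ1)).1
  rw [← integral_trim hm hψ.stronglyMeasurable] at b1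
  have b2 := (abs_le.1 (abs_integral_sub_integral_rnDeriv_mul_le (μ := μ) (ν := ν) hψ0 hψ1)).2
  have b3 := integral_toReal_rnDeriv_le_trim (μ := μ) (ν := ν) hm
  have b4 : ∑ i ∈ t, ∫ x, ((ρ i).rnDeriv ν x).toReal * (g i x * ψ x) ∂ν -
      ∑ i ∈ t, K i * (1 - ∫ x, ((ρ i).rnDeriv ν x).toReal ∂ν) ≤
      ∑ i ∈ t, ∫ x, g i x * ψ x ∂(ρ i) := by
    rw [← Finset.sum_sub_distrib]
    refine Finset.sum_le_sum fun i _ => ?_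
    have := (abs_le.1 (abs_integral_sub_integral_rnDeriv_mul_le (μ := ρ i) (ν := ν)
      (hgψm0 i) (hgψ i))).1
    linarith
  have hint2 : ∀ i, Integrable (fun x => ((ρ i).rnDeriv ν x).toReal * (g i x * ψ x)) ν :=
    fun i => integrable_toReal_rnDeriv_mul_of_abs_le (hgψm0 i) (hgψ i)
  have b5 : ∫ x, (μ.rnDeriv ν x).toReal * ψ x ∂ν -
      ∑ i ∈ t, ∫ x, ((ρ i).rnDeriv ν x).toReal * (g i x * ψ x) ∂ν ≤
      ∫ x, |(μ.rnDeriv ν x).toReal - ∑ i ∈ t, ((ρ i).rnDeriv ν x).toReal * g i x| ∂ν := by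
    rw [← integral_finsetSum t fun i _ => hint2 i,
      ← integral_sub (integrable_toReal_rnDeriv_mul_of_abs_le hψ0 hψ1)
        (integrable_finsetSum t fun i _ => hint2 i)]
    refine integral_mono ((integrable_toReal_rnDeriv_mul_of_abs_le hψ0 hψ1).sub
        (integrable_finsetSum t fun i _ => hint2 i))
      (Integrable.abs (Measure.integrable_toReal_rnDeriv.sub (integrable_finsetSum t fun i _ =>
        integrable_toReal_rnDeriv_mul_of_abs_le ((hg i).mono hm le_rfl) (hK i)))) fun x => ?_
    have : (μ.rnDeriv ν x).toReal * ψ x - ∑ i ∈ t, ((ρ i).rnDeriv ν x).toReal * (g i x * ψ x) =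
        ((μ.rnDeriv ν x).toReal - ∑ i ∈ t, ((ρ i).rnDeriv ν x).toReal * g i x) * ψ x := by
      rw [sub_mul, Finset.sum_mul]
      simp_rw [mul_assoc]
    simp only [this]
    refine (le_abs_self _).trans ?_
    rw [abs_mul]
    exact mul_le_of_le_one_right (abs_nonneg _) (hψ1 x)
  rw [e1]
  linarith

end LebesgueDecomposition

/-! ### Bounded densities of functionals on `L¹` and approximation by duality. -/

section DualOfL1

variable {Ω : Type*} {m0 : MeasurableSpace Ω} {μ : Measure Ω}

/-- For a probability measure `L²` embeds continuously in `L¹`, so the functional restricts to `L²`,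
where the Riesz representation theorem provides `w`. -/
theorem exists_real_density_of_dual_L1 [IsProbabilityMeasure μ] (l : StrongDual ℝ (Lp ℝ 1 μ)) :
    ∃ w : Ω → ℝ, Integrable w μ ∧ ∀ s (hs : MeasurableSet s),
      l (indicatorConstLp 1 hs (measure_ne_top μ s) (1 : ℝ)) = ∫ x in s, w x ∂μ := by
  have hmem : ∀ f : Lp ℝ 2 μ, MemLp f 1 μ := fun f => (Lp.memLp f).mono_exponent (by norm_num)
  let T : Lp ℝ 2 μ →ₗ[ℝ] Lp ℝ 1 μ :=
    { toFun := fun f => (hmem f).toLp f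
      map_add' := fun f g => by
        rw [← MemLp.toLp_add]
        exact MemLp.toLp_congr _ _ (Lp.coeFn_add f g)
      map_smul' := fun c f => by
        rw [RingHom.id_apply, ← MemLp.toLp_const_smul]
        exact MemLp.toLp_congr _ _ (Lp.coeFn_smul c f) }
  have hT : ∀ f, ‖T f‖ ≤ 1 * ‖f‖ := fun f => by
    rw [one_mul]
    change ‖(hmem f).toLp f‖ ≤ _
    rw [Lp.norm_toLp, Lp.norm_def]
    exact ENNReal.toReal_mono (Lp.memLp f).2.ne
      (eLpNorm_le_eLpNorm_of_exponent_le (by norm_num) (Lp.memLp f).1)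
  let l2 : StrongDual ℝ (Lp ℝ 2 μ) := l.comp (T.mkContinuous 1 hT)
  set w := (InnerProductSpace.toDual ℝ (Lp ℝ 2 μ)).symm l2 with hw
  refine ⟨w, (hmem w).integrable le_rfl, fun s hs => ?_⟩
  rw [← L2.inner_indicatorConstLp_one (𝕜 := ℝ) hs (measure_ne_top μ s) w, real_inner_comm, hw,
    InnerProductSpace.toDual_symm_apply]
  change _ = l ((hmem _).toLp _)
  congr 1
  exact MemLp.toLp_congr _ _ indicatorConstLp_coeFn.symm

/-- A continuous linear functional on `L¹` of a probability measure is represented by a bounded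
measurable function. -/
theorem exists_bounded_density_of_dual_L1 [IsProbabilityMeasure μ]
    (l : StrongDual ℝ (Lp ℝ 1 μ)) :
    ∃ (w : Ω → ℝ) (M : ℝ), Measurable w ∧ (∀ x, |w x| ≤ M) ∧
      ∀ (f : Ω → ℝ) (hf : Integrable f μ), l (hf.toL1 f) = ∫ x, w x * f x ∂μ := by
  obtain ⟨w₀, hw₀, hl₀⟩ := exists_real_density_of_dual_L1 l
  have hbd : ∀ s, MeasurableSet s → |∫ x in s, w₀ x ∂μ| ≤ ‖l‖ * μ.real s := fun s hs => by
    rw [← hl₀ s hs]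
    refine (l.le_opNorm _).trans_eq ?_
    rw [norm_indicatorConstLp one_ne_zero ENNReal.one_ne_top]
    simp
  have hub : w₀ ≤ᵐ[μ] fun _ => ‖l‖ :=
    ae_le_of_forall_setIntegral_le hw₀ (integrable_const _) fun s hs _ => by
      rw [setIntegral_const, smul_eq_mul, mul_comm]
      exact (le_abs_self _).trans (hbd s hs)
  have hlb : (fun _ => -‖l‖) ≤ᵐ[μ] w₀ :=
    ae_le_of_forall_setIntegral_le (integrable_const _) hw₀ fun s hs _ => by
      rw [setIntegral_const, smul_eq_mul]
      linarith [(abs_le.1 (hbd s hs)).1]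
  -- A measurable version clipped at `±‖l‖`, to have the bound at every point; by `hub` and `hlb`
  -- clipping changes it only on a null set.
  set w : Ω → ℝ := fun x => max (-‖l‖) (min ‖l‖ (hw₀.aestronglyMeasurable.mk w₀ x)) with hwdef
  have hwm : Measurable w := measurable_const.max
    (measurable_const.min hw₀.aestronglyMeasurable.stronglyMeasurable_mk.measurable)
  have hwM : ∀ x, |w x| ≤ ‖l‖ := fun x => abs_le.2 ⟨le_max_left _ _,
    max_le (by linarith [norm_nonneg l]) (min_le_left _ _)⟩
  have hww : w =ᵐ[μ] w₀ := by
    filter_upwards [hub, hlb, hw₀.aestronglyMeasurable.ae_eq_mk] with x h1 h2 h3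
    rw [hwdef]
    simp only
    rw [← h3, min_eq_right h1, max_eq_right h2]
  have hint : ∀ f : Ω → ℝ, Integrable f μ → Integrable (fun x => w x * f x) μ := fun f hf =>
    hf.bdd_mul hwm.aestronglyMeasurable (Eventually.of_forall hwM)
  refine ⟨w, ‖l‖, hwm, hwM, fun f hf => ?_⟩
  let T : Lp ℝ 1 μ →ₗ[ℝ] ℝ :=
    { toFun := fun f => ∫ x, w x * f x ∂μ
      map_add' := fun f g => by
        rw [← integral_add (hint _ (L1.integrable_coeFn f)) (hint _ (L1.integrable_coeFn g))]
        refine integral_congr_ae ?_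
        filter_upwards [Lp.coeFn_add f g] with x hx
        rw [hx, Pi.add_apply, mul_add]
      map_smul' := fun c f => by
        rw [RingHom.id_apply, smul_eq_mul, ← integral_const_mul]
        refine integral_congr_ae ?_
        filter_upwards [Lp.coeFn_smul c f] with x hx
        rw [hx, Pi.smul_apply, smul_eq_mul]
        ring }
  have hTb : ∀ f, ‖T f‖ ≤ ‖l‖ * ‖f‖ := fun f => by
    rw [L1.norm_eq_integral_norm, ← integral_const_mul]
    refine norm_integral_le_of_norm_le ((L1.integrable_coeFn f).norm.const_mul _)
      (Eventually.of_forall fun x => ?_)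
    rw [norm_mul]
    gcongr
    exact hwM x
  have key : ∀ g : Lp ℝ 1 μ, l g = T.mkContinuous _ hTb g := by
    intro g
    induction g using Lp.induction ENNReal.one_ne_top with
    | indicatorConst c hs hμs =>
      rename_i s
      rw [Lp.simpleFunc.coe_indicatorConst]
      have e : indicatorConstLp 1 hs hμs.ne c =
          c • indicatorConstLp 1 hs (measure_ne_top μ s) (1 : ℝ) := by
        rw [indicatorConstLp, indicatorConstLp, ← MemLp.toLp_const_smul]
        refine MemLp.toLp_congr _ _ (Eventually.of_forall fun x => ?_)
        by_cases hx : x ∈ s <;> simp [hx]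
      rw [e, map_smul, map_smul, hl₀]
      congr 1
      change _ = ∫ x, w x * _ ∂μ
      rw [← integral_indicator hs]
      refine integral_congr_ae ?_
      filter_upwards [hww, indicatorConstLp_coeFn (p := 1) (hs := hs)
        (hμs := measure_ne_top μ s) (c := (1 : ℝ))] with x h1 h2
      rw [h2, h1]
      by_cases hx : x ∈ s <;> simp [hx]
    | add hf hg _ h1 h2 => rw [map_add, map_add, h1, h2]
    | isClosed => exact isClosed_eq l.continuous (T.mkContinuous _ hTb).continuous
  rw [key]
  change ∫ x, w x * _ ∂μ = _
  refine integral_congr_ae ?_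
  filter_upwards [hf.coeFn_toL1] with x hx
  rw [hx]

/-- If every bounded function that annihilates the family `V` annihilates `f`, then `f` can be
approximated in `L¹` by linear combinations of members of `V`. -/
theorem exists_integral_abs_sub_sum_lt [IsProbabilityMeasure μ] {ι : Type*} {V : ι → Ω → ℝ}
    (hV : ∀ i, Integrable (V i) μ) {f : Ω → ℝ} (hf : Integrable f μ)
    (h : ∀ (w : Ω → ℝ) (M : ℝ), Measurable w → (∀ x, |w x| ≤ M) →
      (∀ i, ∫ x, w x * V i x ∂μ = 0) → ∫ x, w x * f x ∂μ = 0)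
    {ε : ℝ} (hε : 0 < ε) :
    ∃ c : ι →₀ ℝ, ∫ x, |f x - ∑ i ∈ c.support, c i * V i x| ∂μ < ε := by
  set p : Submodule ℝ (Lp ℝ 1 μ) := Submodule.span ℝ (Set.range fun i => (hV i).toL1 (V i))
  have hmem : hf.toL1 f ∈ closure (p : Set (Lp ℝ 1 μ)) := by
    by_contra hnot
    obtain ⟨l, b, hlb, hb⟩ := geometric_hahn_banach_point_closed
      (p.convex.closure) isClosed_closure hnot
    have h0 : b < 0 := by simpa using hb 0 (subset_closure p.zero_mem)
    -- A functional bounded below on a subspace vanishes there: otherwise some multiple of `y`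
    -- attains the value `b`.
    have hp : ∀ y ∈ p, l y = 0 := fun y hy => by
      by_contra hne
      have := hb ((b / l y) • y) (subset_closure (p.smul_mem _ hy))
      rw [map_smul, smul_eq_mul, div_mul_cancel₀ _ hne] at this
      exact lt_irrefl _ this
    obtain ⟨w, M, hw, hM, hl⟩ := exists_bounded_density_of_dual_L1 l
    have := h w M hw hM fun i => by
      rw [← hl _ (hV i)]
      exact hp _ (Submodule.subset_span ⟨i, rfl⟩)
    rw [← hl f hf] at this
    linarith
  obtain ⟨y, hy, hdist⟩ := Metric.mem_closure_iff.1 hmem ε hε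
  obtain ⟨c, rfl⟩ := (Finsupp.mem_span_range_iff_exists_finsupp).1 hy
  refine ⟨c, ?_⟩
  rw [dist_eq_norm, L1.norm_eq_integral_norm] at hdist
  refine lt_of_eq_of_lt (integral_congr_ae ?_) hdist
  have hsum : (↑(∑ i ∈ c.support, c i • (hV i).toL1 (V i)) : Ω → ℝ) =ᵐ[μ]
      fun x => ∑ i ∈ c.support, c i * V i x := by
    have h1 : ∀ᵐ x ∂μ, ∀ i ∈ c.support, (c i • (hV i).toL1 (V i) : Lp ℝ 1 μ) x = c i * V i x := by
      rw [Filter.eventually_all_finset]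
      intro i _
      filter_upwards [Lp.coeFn_smul (c i) ((hV i).toL1 (V i)), (hV i).coeFn_toL1] with x h1 h2
      rw [h1, Pi.smul_apply, h2, smul_eq_mul]
    filter_upwards [h1, Lp.coeFn_finsetSum c.support fun i => c i • (hV i).toL1 (V i)] with x h2 h3
    rw [h3]
    simp only [Finset.sum_apply]
    exact Finset.sum_congr rfl h2
  filter_upwards [Lp.coeFn_sub (hf.toL1 f) (c.sum fun i a => a • (hV i).toL1 (V i)),
    hf.coeFn_toL1, hsum] with x h1 h2 h3
  rw [h1, Pi.sub_apply, h2, Real.norm_eq_abs]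
  rw [Finsupp.sum, h3]

end DualOfL1

/-! ### Sufficiency, bounded completeness and density in `L¹`. -/

section Sufficiency

variable {Ω : Type*}

section TwoMeasures

variable {m m₁ m₂ m0 : MeasurableSpace Ω} {μ ν : Measure Ω}

/-- The intersections `s ∩ t` form a π-system generating the join, and the case of the whole space
handles complements. -/
theorem setIntegral_eq_zero_of_sup (h₁ : m₁ ≤ m0) (h₂ : m₂ ≤ m0) {f : Ω → ℝ}
    (hf : Integrable f μ)
    (h : ∀ s t, MeasurableSet[m₁] s → MeasurableSet[m₂] t → ∫ x in s ∩ t, f x ∂μ = 0)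
    {s : Set Ω} (hs : MeasurableSet[m₁ ⊔ m₂] s) : ∫ x in s, f x ∂μ = 0 := by
  have hle : m₁ ⊔ m₂ ≤ m0 := sup_le h₁ h₂
  set C : Set (Set Ω) := {r | ∃ s t, MeasurableSet[m₁] s ∧ MeasurableSet[m₂] t ∧ r = s ∩ t}
  have hgen : m₁ ⊔ m₂ = MeasurableSpace.generateFrom C := by
    refine le_antisymm (sup_le (fun r hr => ?_) fun r hr => ?_)
      (MeasurableSpace.generateFrom_le ?_)
    · exact MeasurableSpace.measurableSet_generateFrom
        ⟨r, Set.univ, hr, MeasurableSet.univ, (Set.inter_univ r).symm⟩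
    · exact MeasurableSpace.measurableSet_generateFrom
        ⟨Set.univ, r, MeasurableSet.univ, hr, (Set.univ_inter r).symm⟩
    · rintro _ ⟨s, t, hs, ht, rfl⟩
      exact MeasurableSet.inter (le_sup_left (a := m₁) (b := m₂) _ hs)
        (le_sup_right (a := m₁) (b := m₂) _ ht)
  have hpi : IsPiSystem C := by
    rintro _ ⟨s, t, hs, ht, rfl⟩ _ ⟨s', t', hs', ht', rfl⟩ _
    exact ⟨s ∩ s', t ∩ t', hs.inter hs', ht.inter ht', Set.inter_inter_inter_comm _ _ _ _⟩
  have huniv : ∫ x, f x ∂μ = 0 := by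
    simpa using h Set.univ Set.univ MeasurableSet.univ MeasurableSet.univ
  induction s, hs using MeasurableSpace.induction_on_inter hgen hpi with
  | empty => simp
  | basic r hr =>
    obtain ⟨s, t, hs, ht, rfl⟩ := hr
    exact h s t hs ht
  | compl r hr ih =>
    have := integral_add_compl (hle _ hr) hf
    linarith
  | iUnion g hd hg ih =>
    rw [integral_iUnion (fun i => hle _ (hg i)) hd hf.integrableOn]
    simp [ih]

/-- Self-adjointness of conditional expectation: pulling out the `m`-measurable factor, both
integrands have the conditional expectation `μ[w | m] * μ[f | m]`. Boundedness of `w` keeps the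
products integrable for `f` merely in `L¹`. -/
theorem integral_mul_condExp_comm [IsProbabilityMeasure μ] (hm : m ≤ m0) {w f : Ω → ℝ}
    (hw : Measurable w) {M : ℝ} (hM : ∀ x, |w x| ≤ M) (hf : Integrable f μ) :
    ∫ x, w x * (μ[f | m]) x ∂μ = ∫ x, (μ[w | m]) x * f x ∂μ := by
  have hwi : Integrable w μ := .of_bound hw.aestronglyMeasurable M (Eventually.of_forall hM)
  have hM0 : 0 ≤ M := by
    obtain ⟨x⟩ := μ.nonempty_of_neZero
    exact (abs_nonneg _).trans (hM x)
  have hbd : ∀ᵐ x ∂μ, |(μ[w | m]) x| ≤ M :=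
    ae_bdd_abs_condExp_of_ae_bdd_abs (Eventually.of_forall hM)
  have i1 : Integrable (w * μ[f | m]) μ :=
    integrable_condExp.bdd_mul hw.aestronglyMeasurable (Eventually.of_forall hM)
  have i2 : Integrable (μ[w | m] * f) μ :=
    hf.bdd_mul (stronglyMeasurable_condExp.mono hm).aestronglyMeasurable hbd
  have e1 := condExp_mul_of_stronglyMeasurable_right (μ := μ) (m := m)
    stronglyMeasurable_condExp i1 hwi
  have e2 := condExp_mul_of_stronglyMeasurable_left (μ := μ) (m := m)
    stronglyMeasurable_condExp i2 hf
  calc ∫ x, w x * (μ[f | m]) x ∂μ = ∫ x, (μ[w * μ[f | m] | m]) x ∂μ := (integral_condExp hm).symm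
    _ = ∫ x, (μ[μ[w | m] * f | m]) x ∂μ := integral_congr_ae (e1.trans e2.symm)
    _ = ∫ x, (μ[w | m]) x * f x ∂μ := integral_condExp hm

/-- If `μ` and `ν` have common conditional probabilities given `m`, then the density of `μ` with
respect to `ν` is almost surely `m`-measurable. -/
theorem condExp_rnDeriv_ae_eq [IsProbabilityMeasure μ] [IsProbabilityMeasure ν] (hm : m ≤ m0)
    (hac : μ ≪ ν)
    (h : ∀ s, MeasurableSet[m0] s →
      ∃ g : Ω → ℝ, Measurable[m] g ∧ g =ᵐ[μ] μ⟦s | m⟧ ∧ g =ᵐ[ν] ν⟦s | m⟧) :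
    ν[fun x => (μ.rnDeriv ν x).toReal | m] =ᵐ[ν] fun x => (μ.rnDeriv ν x).toReal := by
  refine Integrable.ae_eq_of_forall_setIntegral_eq _ _ integrable_condExp
    Measure.integrable_toReal_rnDeriv fun s hs _ => ?_
  obtain ⟨g, -, hgμ, hgν⟩ := h s hs
  have hind : Measurable (s.indicator fun _ => (1 : ℝ)) := measurable_const.indicator hs
  have hle : ∀ x, |s.indicator (fun _ => (1 : ℝ)) x| ≤ 1 := fun x => by
    by_cases hx : x ∈ s <;> simp [hx]
  -- Self-adjointness moves the conditioning onto the indicator of `s`; the common version `g` then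
  -- carries the integral from `ν` to `μ`.
  calc ∫ x in s, (ν[fun x => (μ.rnDeriv ν x).toReal | m]) x ∂ν
      = ∫ x, s.indicator (fun _ => (1 : ℝ)) x * (ν[fun x => (μ.rnDeriv ν x).toReal | m]) x ∂ν := by
        rw [← integral_indicator hs]
        congr 1 with x
        by_cases hx : x ∈ s <;> simp [hx]
    _ = ∫ x, (ν⟦s | m⟧) x * (μ.rnDeriv ν x).toReal ∂ν :=
        integral_mul_condExp_comm hm hind hle Measure.integrable_toReal_rnDeriv
    _ = ∫ x, (μ.rnDeriv ν x).toReal * g x ∂ν := by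
        refine integral_congr_ae ?_
        filter_upwards [hgν] with x hx
        rw [hx, mul_comm]
    _ = ∫ x, g x ∂μ := integral_toReal_rnDeriv_mul hac
    _ = ∫ x, (μ⟦s | m⟧) x ∂μ := integral_congr_ae hgμ
    _ = μ.real s := by rw [integral_condExp hm, integral_indicator_const _ hs]; simp
    _ = ∫ x in s, (μ.rnDeriv ν x).toReal ∂ν := (Measure.setIntegral_toReal_rnDeriv hac s).symm

end TwoMeasures

/-- In an experiment with mutually absolutely continuous measures and a sufficient, boundedly
complete σ-field `F` which together with `A` generates everything, a bounded function orthogonal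
to all products of likelihood ratios and `A`-measurable indicators vanishes almost surely. -/
theorem ae_eq_zero_of_forall_integral_rnDeriv_indicator_eq_zero {Υ : Type*}
    {F A m0 : MeasurableSpace Ω}
    {P : Υ → Measure Ω} [∀ η, IsProbabilityMeasure (P η)] (hAC : ∀ η η', P η ≪ P η')
    (hFle : F ≤ m0)
    (hF : ∀ s, MeasurableSet s →
      ∃ g : Ω → ℝ, Measurable[F] g ∧ ∀ η, g =ᵐ[P η] (P η)⟦s | F⟧)
    (hFc : ∀ g : Ω → ℝ, Measurable[F] g → (∃ M : ℝ, ∀ x, |g x| ≤ M) →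
      (∀ η, ∫ x, g x ∂(P η) = 0) → ∀ η, g =ᵐ[P η] 0)
    (hA : A ≤ m0)
    (hgen : ∀ s, MeasurableSet s → ∃ t, MeasurableSet[F ⊔ A] t ∧ ∀ η, P η (symmDiff s t) = 0)
    (η₀ : Υ) {w : Ω → ℝ} {M : ℝ} (hw : Measurable w) (hM : ∀ x, |w x| ≤ M)
    (h : ∀ η s, MeasurableSet[A] s →
      ∫ x, w x * (((P η).rnDeriv (P η₀) x).toReal * s.indicator 1 x) ∂(P η₀) = 0) :
    w =ᵐ[P η₀] 0 := by
  have hwi : Integrable w (P η₀) := .of_bound hw.aestronglyMeasurable M (Eventually.of_forall hM)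
  have hM0 : 0 ≤ M := by
    obtain ⟨x⟩ := (P η₀).nonempty_of_neZero
    exact (abs_nonneg _).trans (hM x)
  have key : ∀ s t, MeasurableSet[F] s → MeasurableSet[A] t →
      ∫ x in s ∩ t, w x ∂(P η₀) = 0 := by
    intro s t hs ht
    set wt : Ω → ℝ := t.indicator w with hwt
    have hwtm : Measurable wt := hw.indicator (hA _ ht)
    have hwtM : ∀ x, |wt x| ≤ M := fun x => by
      by_cases hx : x ∈ t
      · simpa [hwt, hx] using hM x
      · simpa [hwt, hx] using hM0
    have hwti : Integrable wt (P η₀) :=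
      .of_bound hwtm.aestronglyMeasurable M (Eventually.of_forall hwtM)
    -- Bounded completeness asks for an `F`-measurable function bounded at every point, hence the
    -- clipping of the conditional expectation.
    set q : Ω → ℝ := fun x => max (-M) (min M (((P η₀)[wt | F]) x)) with hq
    have hqm : Measurable[F] q := Measurable.max (@measurable_const _ _ _ F _)
      (Measurable.min (@measurable_const _ _ _ F _) stronglyMeasurable_condExp.measurable)
    have hqM : ∀ x, |q x| ≤ M := fun x => abs_le.2 ⟨le_max_left _ _,
      max_le (by linarith) (min_le_left _ _)⟩
    have hbd : ∀ᵐ x ∂(P η₀), |((P η₀)[wt | F]) x| ≤ M :=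
      ae_bdd_abs_condExp_of_ae_bdd_abs (Eventually.of_forall hwtM)
    have hqe : q =ᵐ[P η₀] (P η₀)[wt | F] := by
      filter_upwards [hbd] with x hx
      rw [hq]
      simp only
      rw [min_eq_right (abs_le.1 hx).2, max_eq_right (abs_le.1 hx).1]
    have hq0 : ∀ η, ∫ x, q x ∂(P η) = 0 := fun η => by
      have e1 := condExp_rnDeriv_ae_eq (μ := P η) (ν := P η₀) hFle (hAC η η₀) fun s hs => by
        obtain ⟨g, hg, hgP⟩ := hF s hs
        exact ⟨g, hg, hgP η, hgP η₀⟩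
      rw [← integral_toReal_rnDeriv_mul (hAC η η₀), ← h η t ht]
      calc ∫ x, ((P η).rnDeriv (P η₀) x).toReal * q x ∂(P η₀)
          = ∫ x, ((P η₀)[wt | F]) x * ((P η).rnDeriv (P η₀) x).toReal ∂(P η₀) := by
            refine integral_congr_ae ?_
            filter_upwards [hqe] with x hx
            rw [hx, mul_comm]
        _ = ∫ x, wt x * ((P η₀)[fun x => ((P η).rnDeriv (P η₀) x).toReal | F]) x
              ∂(P η₀) :=
            (integral_mul_condExp_comm hFle hwtm hwtM Measure.integrable_toReal_rnDeriv).symm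
        _ = ∫ x, w x * (((P η).rnDeriv (P η₀) x).toReal * t.indicator 1 x) ∂(P η₀) := by
            refine integral_congr_ae ?_
            filter_upwards [e1] with x hx
            rw [hx]
            by_cases hxt : x ∈ t <;> simp [hwt, hxt]
    have hqz := hFc q hqm ⟨M, hqM⟩ hq0 η₀
    calc ∫ x in s ∩ t, w x ∂(P η₀) = ∫ x in s, wt x ∂(P η₀) := by
          rw [hwt, setIntegral_indicator (hA _ ht)]
      _ = ∫ x in s, ((P η₀)[wt | F]) x ∂(P η₀) := (setIntegral_condExp hFle hwti hs).symm
      _ = ∫ x in s, 0 ∂(P η₀) :=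
          integral_congr_ae (ae_restrict_of_ae (hqe.symm.trans hqz))
      _ = 0 := integral_zero _ _
  refine Integrable.ae_eq_zero_of_forall_setIntegral_eq_zero hwi fun s hs _ => ?_
  obtain ⟨t, ht, hst⟩ := hgen s hs
  rw [setIntegral_congr_set (measure_symmDiff_eq_zero_iff.1 (hst η₀))]
  exact setIntegral_eq_zero_of_sup hFle hA hwi key ht

/-- Under the assumptions of bounded completeness and generation, every integrable variable is
approximated in `L¹` by linear combinations of products of likelihood ratios and `A`-measurable
indicators. -/
theorem exists_integral_abs_sub_sum_rnDeriv_lt {Υ : Type*} {F A m0 : MeasurableSpace Ω}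
    {P : Υ → Measure Ω} [∀ η, IsProbabilityMeasure (P η)] (hAC : ∀ η η', P η ≪ P η')
    (hFle : F ≤ m0)
    (hF : ∀ s, MeasurableSet s →
      ∃ g : Ω → ℝ, Measurable[F] g ∧ ∀ η, g =ᵐ[P η] (P η)⟦s | F⟧)
    (hFc : ∀ g : Ω → ℝ, Measurable[F] g → (∃ M : ℝ, ∀ x, |g x| ≤ M) →
      (∀ η, ∫ x, g x ∂(P η) = 0) → ∀ η, g =ᵐ[P η] 0)
    (hA : A ≤ m0)
    (hgen : ∀ s, MeasurableSet s → ∃ t, MeasurableSet[F ⊔ A] t ∧ ∀ η, P η (symmDiff s t) = 0)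
    (η₀ : Υ) {f : Ω → ℝ} (hf : Integrable f (P η₀)) {ε : ℝ} (hε : 0 < ε) :
    ∃ c : (Υ × {s : Set Ω // MeasurableSet[A] s}) →₀ ℝ,
      ∫ x, |f x - ∑ i ∈ c.support,
        c i * (((P i.1).rnDeriv (P η₀) x).toReal * (i.2 : Set Ω).indicator 1 x)| ∂(P η₀) < ε := by
  refine exists_integral_abs_sub_sum_lt (fun i => ?_) hf (fun w M hw hM h0 => ?_) hε
  · refine integrable_toReal_rnDeriv_mul_of_abs_le (measurable_one.indicator (hA _ i.2.2))
      (K := 1) fun x => ?_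
    by_cases hx : x ∈ (i.2 : Set Ω) <;> simp [hx]
  · have := ae_eq_zero_of_forall_integral_rnDeriv_indicator_eq_zero hAC hFle hF hFc hA hgen η₀ hw hM
      fun η s hs => h0 ⟨η, s, hs⟩
    rw [integral_congr_ae (g := 0)]
    · simp
    · filter_upwards [this] with x hx
      simp [hx]

end Sufficiency

/-! ### Continuous encoding of events and approximation in mean. -/

/-- Finitely many measurable sets can be encoded in one real measurable function, in such a way that
their indicators are recovered by bounded continuous functions. -/
theorem exists_measurable_encoding {Ω ι : Type*} {m : MeasurableSpace Ω} (t : Finset ι)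
    (s : ι → Set Ω) (hs : ∀ i, MeasurableSet (s i)) :
    ∃ (ξ : Ω → ℝ) (γ : ι → ℝ → ℝ), Measurable ξ ∧ (∀ i, Continuous (γ i)) ∧
      (∀ i x, |γ i x| ≤ 1) ∧ ∀ i ∈ t, ∀ ω, γ i (ξ ω) = (s i).indicator 1 ω := by
  classical
  -- The code of a point is the number of its membership pattern. Codes form a closed discrete
  -- subset of `ℝ`, so reading off one membership extends continuously by Tietze with the same
  -- bound.
  obtain ⟨N, ⟨e⟩⟩ := Finite.exists_equiv_fin (t → Bool)
  have hemb : IsClosedEmbedding (fun k : Fin N => ((k : ℕ) : ℝ)) :=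
    Nat.isClosedEmbedding_coe_real.comp
      (.of_continuous_injective_isClosedMap continuous_of_discreteTopology
        Fin.val_injective fun _ _ => isClosed_discrete _)
  set f : ∀ i, Fin N → ℝ := fun i k => if h : i ∈ t then (if e.symm k ⟨i, h⟩ then 1 else 0) else 0
    with hf
  have hf1 : ∀ i k, ‖f i k‖ ≤ 1 := fun i k => by
    simp only [hf]
    split_ifs <;> simp
  have hext : ∀ i, ∃ g : BoundedContinuousFunction ℝ ℝ, ‖g‖ ≤ 1 ∧
      ∀ k : Fin N, g ((k : ℕ) : ℝ) = f i k := fun i => by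
    set f' : BoundedContinuousFunction (Fin N) ℝ := BoundedContinuousFunction.ofNormedAddCommGroup
      (f i) continuous_of_discreteTopology 1 (hf1 i)
    obtain ⟨g, hg, hgf⟩ := f'.exists_extension_norm_eq_of_isClosedEmbedding hemb
    refine ⟨g, hg.trans_le ((BoundedContinuousFunction.norm_le zero_le_one).2 (hf1 i)), fun k => ?_⟩
    exact congrFun hgf k
  choose g hg1 hg using hext
  refine ⟨fun ω => ((e fun i => decide (ω ∈ s i) : ℕ) : ℝ), fun i => g i, ?_,
    fun i => (g i).continuous, fun i x => ((g i).norm_coe_le_norm x).trans (hg1 i),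
    fun i hi ω => ?_⟩
  · have h1 : Measurable fun ω => fun i : t => decide (ω ∈ s i) := by
      refine measurable_pi_lambda _ fun i => ?_
      exact measurable_to_bool (by simpa [Set.preimage] using hs i)
    have h2 : Measurable fun b : t → Bool => ((e b : ℕ) : ℝ) := .of_discrete
    exact h2.comp h1
  · simp only [hg, hf, dif_pos hi, Equiv.symm_apply_apply]
    by_cases h : ω ∈ s i <;> simp [h]

theorem abs_integral_lipschitz_sub_le {Ω S : Type*} {m : MeasurableSpace Ω} {ν : Measure Ω}
    [IsProbabilityMeasure ν] [PseudoMetricSpace S] {mS : MeasurableSpace S} [BorelSpace S]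
    {g : S → ℝ} {K : ℝ} {L : NNReal} (hK : ∀ x, |g x| ≤ K) (hL : LipschitzWith L g)
    {A B : Ω → S} (hA : AEMeasurable A ν) (hB : AEMeasurable B ν)
    (hAB : Integrable (fun ω => dist (A ω) (B ω)) ν) :
    |∫ ω, g (A ω) ∂ν - ∫ ω, g (B ω) ∂ν| ≤ L * ∫ ω, dist (A ω) (B ω) ∂ν := by
  have hi : ∀ C : Ω → S, AEMeasurable C ν → Integrable (fun ω => g (C ω)) ν := fun C hC =>
    .of_bound (hL.continuous.measurable.comp_aemeasurable hC).aestronglyMeasurable K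
      (Eventually.of_forall fun ω => hK _)
  rw [← integral_sub (hi A hA) (hi B hB), ← integral_const_mul]
  refine norm_integral_le_of_norm_le (f := fun ω => g (A ω) - g (B ω)) (hAB.const_mul (L : ℝ))
    (Eventually.of_forall fun ω => ?_)
  rw [← dist_eq_norm]
  exact hL.dist_le_mul _ _

section ConvergenceInDistribution

variable {S Ω' : Type*} {Ω : ℕ → Type*} {m : ∀ i, MeasurableSpace (Ω i)}
  {μ : (i : ℕ) → Measure (Ω i)} [∀ i, IsProbabilityMeasure (μ i)]
  {m' : MeasurableSpace Ω'} {μ' : Measure Ω'} [IsProbabilityMeasure μ']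
  {mS : MeasurableSpace S} {X : (i : ℕ) → Ω i → S} {Z : Ω' → S}

/-- The means of a nonnegative continuous function converge if they do not exceed the limit. -/
theorem MeasureTheory.TendstoInDistribution.tendsto_integral_of_le
    [TopologicalSpace S] [BorelSpace S]
    (h : TendstoInDistribution X atTop Z μ μ') {f : S → ℝ} (hf : Continuous f)
    (hf0 : ∀ x, 0 ≤ f x) (hfX : ∀ n, Integrable (fun ω => f (X n ω)) (μ n))
    (hfZ : Integrable (fun ω => f (Z ω)) μ')
    (hle : ∀ n, ∫ ω, f (X n ω) ∂μ n ≤ ∫ ω, f (Z ω) ∂μ') :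
    Tendsto (fun n => ∫ ω, f (X n ω) ∂μ n) atTop (𝓝 (∫ ω, f (Z ω) ∂μ')) :=
  tendsto_order.2 ⟨fun _ hc => h.eventually_lt_integral hf hf0 hfX hfZ hc,
    fun _ hc => Eventually.of_forall fun n => (hle n).trans_lt hc⟩

/-- Convergence in distribution of variables that are approximated in mean by variables which
converge in distribution. -/
theorem tendstoInDistribution_of_approx [PseudoMetricSpace S] [BorelSpace S]
    (hX : ∀ n, AEMeasurable (X n) (μ n)) (hZ : AEMeasurable Z μ')
    (h : ∀ ε > 0, ∃ (Y : ∀ n, Ω n → S) (W : Ω' → S), TendstoInDistribution Y atTop W μ μ' ∧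
      (∀ᶠ n in atTop, Integrable (fun ω => dist (X n ω) (Y n ω)) (μ n) ∧
        ∫ ω, dist (X n ω) (Y n ω) ∂μ n ≤ ε) ∧
      Integrable (fun ω => dist (Z ω) (W ω)) μ' ∧ ∫ ω, dist (Z ω) (W ω) ∂μ' ≤ ε) :
    TendstoInDistribution X atTop Z μ μ' := by
  refine tendstoInDistribution_of_forall_lipschitz hX hZ fun g K L hK hL => ?_
  rw [Metric.tendsto_atTop']
  intro ε hε
  have hL0 : (0 : ℝ) ≤ L := L.2
  -- Three errors of at most `ε / 4` each will add up; `L + 1` avoids division by zero.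
  obtain ⟨Y, W, hYW, hXY, hZW, hZWε⟩ := h (ε / (4 * (L + 1))) (by positivity)
  have hLε : L * (ε / (4 * (L + 1))) ≤ ε / 4 := by
    rw [mul_div_assoc', div_le_div_iff₀ (by positivity) (by positivity)]
    nlinarith
  have h1 := hYW.tendsto_integral hL.continuous hK
  obtain ⟨N, hN⟩ := Metric.tendsto_atTop'.1 h1 (ε / 4) (by positivity)
  obtain ⟨N', hN'⟩ := eventually_atTop.1 hXY
  refine ⟨max N N', fun n hn => ?_⟩
  have b1 := hN n ((le_max_left _ _).trans_lt hn)
  obtain ⟨hi, hiε⟩ := hN' n ((le_max_right _ _).trans hn.le)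
  have b2 := (abs_integral_lipschitz_sub_le hK hL (hX n) (hYW.forall_aemeasurable n) hi).trans
    ((mul_le_mul_of_nonneg_left hiε hL0).trans hLε)
  have b3 := (abs_integral_lipschitz_sub_le hK hL hZ hYW.aemeasurable_limit hZW).trans
    ((mul_le_mul_of_nonneg_left hZWε hL0).trans hLε)
  rw [Real.dist_eq, abs_lt] at *
  rw [abs_le] at b2 b3
  constructor <;> linarith [b1.1, b1.2, b2.1, b2.2, b3.1, b3.2]

end ConvergenceInDistribution

/-! ### Likelihood ratios and change of base point. -/

namespace StatExperiment

variable {Θ : Type w}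

theorem measurable_lr (E : StatExperiment.{w, u} Θ) (h₀ h : Θ) : Measurable (E.lr h₀ h) :=
  (Measure.measurable_rnDeriv _ _).ennreal_toReal

theorem measurable_lr_pi (E : StatExperiment.{w, u} Θ) (h₀ : Θ) (J : Finset Θ) :
    Measurable fun (x : E.carrier) (h : J) => E.lr h₀ h x :=
  measurable_pi_lambda _ fun h => E.measurable_lr h₀ h

theorem integrable_lr (E : StatExperiment.{w, u} Θ) (h₀ h : Θ) :
    Integrable (E.lr h₀ h) (E.P h₀) :=
  Measure.integrable_toReal_rnDeriv

theorem lr_nonneg (E : StatExperiment.{w, u} Θ) (h₀ h : Θ) (x : E.carrier) : 0 ≤ E.lr h₀ h x :=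
  ENNReal.toReal_nonneg

theorem integral_lr_le_one (E : StatExperiment.{w, u} Θ) (h₀ h : Θ) :
    ∫ x, E.lr h₀ h x ∂(E.P h₀) ≤ 1 :=
  integral_toReal_rnDeriv_le_one

theorem MutuallyAC.integral_lr {E : StatExperiment.{w, u} Θ} (hE : E.MutuallyAC) (h₀ h : Θ) :
    ∫ x, E.lr h₀ h x ∂(E.P h₀) = 1 :=
  (Measure.integral_toReal_rnDeriv (hE h h₀)).trans probReal_univ

theorem MutuallyAC.restrict {E : StatExperiment.{w, u} Θ} (hE : E.MutuallyAC)
    (A : MeasurableSpace E.carrier) (hA : A ≤ E.sigma) : (E.restrict A hA).MutuallyAC :=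
  fun h h' => (hE h h').trim hA

/-- If likelihood ratios occur as continuous coordinates of a sequence converging in distribution
and the limit is absolutely continuous, then no mass is lost. -/
theorem tendsto_integral_lr {En : ℕ → StatExperiment.{w, u} Θ} {E : StatExperiment.{w, v} Θ}
    (hAC : E.MutuallyAC) {h₀ h : Θ} {S : Type*} [TopologicalSpace S] [MeasurableSpace S]
    [BorelSpace S] {X : ∀ n, (En n).carrier → S} {Z : E.carrier → S}
    (hXZ : TendstoInDistribution X atTop Z (fun n => (En n).P h₀) (E.P h₀))
    {p : S → ℝ} (hp : Continuous p) (hpX : ∀ n x, p (X n x) = (En n).lr h₀ h x)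
    (hpZ : ∀ x, p (Z x) = E.lr h₀ h x) :
    Tendsto (fun n => ∫ x, (En n).lr h₀ h x ∂((En n).P h₀)) atTop (𝓝 1) := by
  -- The coordinate `p` is known to be nonnegative only on the values taken; `|p|` is nonnegative on
  -- all of `S`.
  have e1 : ∀ n x, |p (X n x)| = (En n).lr h₀ h x := fun n x => by
    rw [hpX, abs_of_nonneg (lr_nonneg _ _ _ _)]
  have e2 : ∀ x, |p (Z x)| = E.lr h₀ h x := fun x => by
    rw [hpZ, abs_of_nonneg (lr_nonneg _ _ _ _)]
  have := hXZ.tendsto_integral_of_le hp.abs (fun x => abs_nonneg _)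
    (fun n => by simpa only [e1] using (En n).integrable_lr h₀ h)
    (by simpa only [e2] using E.integrable_lr h₀ h)
    (fun n => by simpa only [e1, e2, hAC.integral_lr] using (En n).integral_lr_le_one h₀ h)
  simpa only [e1, e2, hAC.integral_lr] using this

/-- Change of base point for a bounded function of the likelihood ratios. -/
theorem abs_integral_sub_integral_lr_le (E : StatExperiment.{w, u} Θ) (h₀ h₁ : Θ) (J : Finset Θ)
    {g : (J → ℝ) → ℝ} (hg : Measurable g) {K : ℝ} (hK : ∀ r, |g r| ≤ K) :
    |∫ x, g (fun h => E.lr h₁ h x) ∂(E.P h₁) -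
        ∫ x, E.lr h₀ h₁ x * g (fun h => E.lr h₀ h x / E.lr h₀ h₁ x) ∂(E.P h₀)| ≤
      K * (1 - ∫ x, E.lr h₀ h₁ x ∂(E.P h₀)) := by
  have hm : Measurable fun x => g (fun h : J => E.lr h₁ h x) :=
    hg.comp (E.measurable_lr_pi h₁ J)
  have := abs_integral_sub_integral_rnDeriv_mul_le (μ := E.P h₁) (ν := E.P h₀) hm fun x => hK _
  convert! this using 3
  refine integral_congr_ae ?_
  have hall : ∀ᵐ x ∂(E.P h₀), ∀ h : J, (E.P h₁).rnDeriv (E.P h₀) x ≠ 0 →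
      (E.P h).rnDeriv (E.P h₁) x * (E.P h₁).rnDeriv (E.P h₀) x = (E.P h).rnDeriv (E.P h₀) x :=
    eventually_all.2 fun h => rnDeriv_mul_rnDeriv_ae_withDensity _ _ _
  filter_upwards [hall, (E.P h₁).rnDeriv_ne_top (E.P h₀)] with x hx hxt
  change E.lr h₀ h₁ x * _ = E.lr h₀ h₁ x * _
  by_cases h0 : (E.P h₁).rnDeriv (E.P h₀) x = 0
  · simp [lr, h0]
  · congr 2
    ext h
    rw [div_eq_iff (show E.lr h₀ h₁ x ≠ 0 from ENNReal.toReal_ne_zero.2 ⟨h0, hxt⟩), lr, lr, lr,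
      ← ENNReal.toReal_mul, hx h h0]

/-- **Change of base point** in the weak convergence of experiments: if the limit experiment
consists of mutually absolutely continuous measures, it suffices to consider one base point. -/
theorem weakConv_of_base {En : ℕ → StatExperiment.{w, u} Θ} {E : StatExperiment.{w, v} Θ}
    (hAC : E.MutuallyAC) (h₀ : Θ)
    (hconv : ∀ J : Finset Θ, TendstoInDistribution
      (fun (n : ℕ) (x : (En n).carrier) (h : J) => (En n).lr h₀ h x) atTop
      (fun (x : E.carrier) (h : J) => E.lr h₀ h x) (fun n => (En n).P h₀) (E.P h₀)) :
    WeakConv En E := by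
  classical
  intro h₁ J
  refine tendstoInDistribution_of_forall_lipschitz
    (fun n => ((En n).measurable_lr_pi h₁ J).aemeasurable)
    (E.measurable_lr_pi h₁ J).aemeasurable fun g K L hK hL => ?_
  set J' := insert h₁ J
  let i₁ : J' := ⟨h₁, Finset.mem_insert_self h₁ J⟩
  let ι : J → J' := fun h => ⟨h, Finset.mem_insert_of_mem h.2⟩
  -- The integrand after the change of base point. At `r i₁ = 0` the quotients are meaningless, but
  -- the bound `hGK` forces continuity there.
  let G : (J' → ℝ) → ℝ := fun r => |r i₁| * g (fun h => r (ι h) / |r i₁|)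
  have hGK : ∀ r, |G r| ≤ K * |r i₁| := fun r => by
    rw [abs_mul, abs_abs, mul_comm]
    gcongr
    exact hK _
  have hGc : Continuous G := by
    refine continuous_iff_continuousAt.2 fun r => ?_
    by_cases hr : r i₁ = 0
    · have h0 : G r = 0 := by simp [G, hr]
      rw [ContinuousAt, h0]
      refine squeeze_zero_norm hGK ?_
      have : Continuous fun r : J' → ℝ => K * |r i₁| := by fun_prop
      simpa [hr] using this.tendsto r
    · have hc₁ : ContinuousAt (fun r : J' → ℝ => |r i₁|) r := (continuous_apply i₁).abs.continuousAt
      refine ContinuousAt.mul hc₁ (hL.continuous.continuousAt.comp ?_)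
      refine continuousAt_pi.2 fun h => ContinuousAt.div
        (continuous_apply (ι h)).continuousAt hc₁ ?_
      exact abs_ne_zero.2 hr
  have hlim := tendsto_integral_lr hAC (h := h₁) (hconv J') (p := fun r => r i₁)
    (continuous_apply i₁) (fun n x => rfl) (fun x => rfl)
  have hK0 : 0 ≤ K := (abs_nonneg _).trans (hK 0)
  have hGlim := (hconv J').tendsto_integral_of_abs_le (a := fun r => K * |r i₁|)
    (continuous_const.mul (continuous_apply i₁).abs) hGc hGK
    (fun n => ((En n).integrable_lr h₀ h₁).abs.const_mul K)
    ((E.integrable_lr h₀ h₁).abs.const_mul K) (by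
      simp only [i₁, abs_of_nonneg (lr_nonneg _ _ _ _), integral_const_mul, hAC.integral_lr]
      exact hlim.const_mul K)
  simp only [G, i₁, ι, abs_of_nonneg (lr_nonneg _ _ _ _)] at hGlim
  -- The change of base point is exact in the limit; along the sequence its error is `K` times the
  -- lost mass, which tends to zero.
  have hE := E.abs_integral_sub_integral_lr_le h₀ h₁ J hL.continuous.measurable hK
  rw [hAC.integral_lr, sub_self, mul_zero, abs_nonpos_iff, sub_eq_zero] at hE
  rw [hE]
  have hdef : Tendsto (fun n => K * (1 - ∫ x, (En n).lr h₀ h₁ x ∂((En n).P h₀))) atTop (𝓝 0) := by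
    simpa using (hlim.const_sub 1).const_mul K
  refine tendsto_of_tendsto_of_dist hGlim (squeeze_zero (fun n => dist_nonneg) (fun n => ?_) hdef)
  rw [dist_comm]
  exact (En n).abs_integral_sub_integral_lr_le h₀ h₁ J hL.continuous.measurable hK

end StatExperiment

/-! ### Approximation of restricted likelihood ratios along the sequence. -/

namespace StatExperiment

variable {Θ : Type w} {Υ : Type w'}

/-- Approximating a likelihood ratio in `L¹` by a combination of likelihood ratios of a
subexperiment, with coefficients measurable for an ancillary σ-field `A` of the subexperiment,
approximates the likelihood ratio of the restriction to `A` by the sum of the coefficients. -/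
theorem integral_abs_lr_restrict_sub_sum_le (E : StatExperiment.{w, u} Θ) (f : Υ → Θ) (η₀ : Υ)
    {A : MeasurableSpace E.carrier} (hA : A ≤ E.sigma) (hanc : (E.reparam f).IsAncillary A) (h : Θ)
    {ι : Type*} (t : Finset ι) (η : ι → Υ) (c : ι → ℝ) (g : ι → E.carrier → ℝ)
    (hg : ∀ i, Measurable[A] (g i)) (hg1 : ∀ i x, |g i x| ≤ 1) :
    ∫ x, |(E.restrict A hA).lr (f η₀) h x - ∑ i ∈ t, c i * g i x| ∂((E.restrict A hA).P (f η₀)) ≤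
      ∫ x, |E.lr (f η₀) h x - ∑ i ∈ t, c i * (E.lr (f η₀) (f (η i)) x * g i x)| ∂(E.P (f η₀)) +
      2 * (1 - ∫ x, E.lr (f η₀) h x ∂(E.P (f η₀))) +
      ∑ i ∈ t, |c i| * (1 - ∫ x, E.lr (f η₀) (f (η i)) x ∂(E.P (f η₀))) := by
  have := integral_abs_rnDeriv_trim_sub_sum_le (μ := E.P h) (ν := E.P (f η₀)) hA t
    (fun i => E.P (f (η i))) (fun i s hs => hanc.2 s hs (η i) η₀)
    (fun i x => c i * g i x)
    (fun i => (hg i).const_mul (c i)) (fun i => |c i|)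
    (fun i x => by rw [abs_mul]; exact mul_le_of_le_one_right (abs_nonneg _) (hg1 i x))
  simp_rw [mul_left_comm _ (c _) (g _ _)] at this
  exact this

theorem integrable_abs_lr_add_sum (E : StatExperiment.{w, u} Θ) (h₀ h : Θ) {ι : Type*}
    (t : Finset ι) (θ : ι → Θ) (c : ι → ℝ) :
    Integrable (fun x => |E.lr h₀ h x| + ∑ i ∈ t, c i * |E.lr h₀ (θ i) x|) (E.P h₀) :=
  (E.integrable_lr h₀ h).abs.add
    (integrable_finsetSum _ fun _ _ => (E.integrable_lr h₀ _).abs.const_mul _)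

theorem integral_abs_lr_add_sum (E : StatExperiment.{w, u} Θ) (h₀ h : Θ) {ι : Type*}
    (t : Finset ι) (θ : ι → Θ) (c : ι → ℝ) :
    ∫ x, (|E.lr h₀ h x| + ∑ i ∈ t, c i * |E.lr h₀ (θ i) x|) ∂(E.P h₀) =
      ∫ x, E.lr h₀ h x ∂(E.P h₀) + ∑ i ∈ t, c i * ∫ x, E.lr h₀ (θ i) x ∂(E.P h₀) := by
  simp only [abs_of_nonneg (lr_nonneg _ _ _ _)]
  rw [integral_add (E.integrable_lr h₀ h)
    (integrable_finsetSum _ fun i _ => (E.integrable_lr h₀ _).const_mul _),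
    integral_finsetSum _ fun i _ => (E.integrable_lr h₀ _).const_mul _]
  simp only [integral_const_mul]

variable {En : ℕ → StatExperiment.{w, u} Θ} {E : StatExperiment.{w, v} Θ}

/-- Convergence of the means of the absolute value of an affine combination of likelihood ratios
with coefficients depending on a weakly converging variable. -/
theorem VarWeakConv.tendsto_integral_abs_lr_sub_sum (hAC : E.MutuallyAC) {h₀ : Θ}
    {ξn : ∀ n, (En n).carrier → ℝ} {ξ : E.carrier → ℝ} (hξ : VarWeakConv En E h₀ ξn ξ)
    (h : Θ) {ι : Type*} (t : Finset ι) (θ : ι → Θ) (c : ι → ℝ) (γ : ι → ℝ → ℝ)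
    (hγ : ∀ i, Continuous (γ i)) (hγ1 : ∀ i x, |γ i x| ≤ 1) :
    Tendsto (fun n => ∫ x, |(En n).lr h₀ h x - ∑ i ∈ t, c i * ((En n).lr h₀ (θ i) x *
      γ i (ξn n x))| ∂((En n).P h₀)) atTop
      (𝓝 (∫ x, |E.lr h₀ h x - ∑ i ∈ t, c i * (E.lr h₀ (θ i) x * γ i (ξ x))| ∂(E.P h₀))) := by
  classical
  set J : Finset Θ := insert h (t.image θ)
  let i₀ : J := ⟨h, Finset.mem_insert_self _ _⟩
  let e : t → J := fun i => ⟨θ i, Finset.mem_insert_of_mem (Finset.mem_image_of_mem θ i.2)⟩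
  have hc₀ : Continuous fun r : (J → ℝ) × ℝ => r.1 i₀ := (continuous_apply i₀).comp continuous_fst
  have hce : ∀ i, Continuous fun r : (J → ℝ) × ℝ => r.1 (e i) := fun i =>
    (continuous_apply (e i)).comp continuous_fst
  have hcγ : ∀ i, Continuous fun r : (J → ℝ) × ℝ => γ i r.2 := fun i => (hγ i).comp continuous_snd
  have hlim : ∀ j : J, Tendsto (fun n => ∫ x, (En n).lr h₀ j x ∂((En n).P h₀)) atTop (𝓝 1) :=
    fun j => tendsto_integral_lr hAC (hξ J) (p := fun r => r.1 j)
      ((continuous_apply j).comp continuous_fst) (fun _ _ => rfl) fun _ => rfl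
  -- The dominating function is a combination of likelihood ratios, whose means all tend to `1`.
  have := (hξ J).tendsto_integral_of_abs_le
    (a := fun r => |r.1 i₀| + ∑ i ∈ t.attach, |c i| * |r.1 (e i)|)
    (G := fun r => |r.1 i₀ - ∑ i ∈ t.attach, c i * (r.1 (e i) * γ i r.2)|)
    (hc₀.abs.add (continuous_finsetSum _ fun i _ => continuous_const.mul (hce i).abs))
    (hc₀.sub (continuous_finsetSum _ fun i _ =>
      continuous_const.mul ((hce i).mul (hcγ i)))).abs
    (fun r => ?_) (fun n => ?_) ?_ ?_
  · have hattach : ∀ a : ι → ℝ, ∑ i ∈ t, a i = ∑ i ∈ t.attach, a i := fun a =>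
      (Finset.sum_attach t a).symm
    simp only [hattach]
    exact this
  · rw [abs_abs]
    refine (abs_sub _ _).trans (add_le_add_right ((Finset.abs_sum_le_sum_abs _ _).trans
      (Finset.sum_le_sum fun i _ => ?_)) _)
    rw [abs_mul, abs_mul]
    gcongr
    exact mul_le_of_le_one_right (abs_nonneg _) (hγ1 _ _)
  · exact integrable_abs_lr_add_sum (En n) h₀ h t.attach (fun i => θ i) (fun i => |c i|)
  · exact integrable_abs_lr_add_sum E h₀ h t.attach (fun i => θ i) (fun i => |c i|)
  · have hE := integral_abs_lr_add_sum E h₀ h t.attach (fun i => θ i) (fun i => |c i|)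
    have hEn := fun n =>
      integral_abs_lr_add_sum (En n) h₀ h t.attach (fun i => θ i) (fun i => |c i|)
    simp only [hAC.integral_lr] at hE
    refine Tendsto.congr (fun n => (hEn n).symm) ?_
    change Tendsto _ _ (𝓝 (∫ x, (|E.lr h₀ h x| +
      ∑ i ∈ t.attach, |c i| * |E.lr h₀ (θ i) x|) ∂(E.P h₀)))
    rw [hE]
    exact (hlim i₀).add (tendsto_finsetSum _ fun i _ => (hlim (e i)).const_mul _)

/-- The key approximation: the likelihood ratios of the restrictions are approximated in `L¹` by the
same bounded continuous functions of weakly converging variables. -/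
theorem exists_approx_lr_restrict (f : Υ → Θ) (η₀ : Υ) (hAC : E.MutuallyAC)
    {F Bd : MeasurableSpace E.carrier} (hF : (E.reparam f).IsSufficient F)
    (hFc : (E.reparam f).IsBoundedlyComplete F) (hBd : Bd ≤ E.sigma)
    (hBda : (E.reparam f).IsAncillary Bd) (hgen : (E.reparam f).EssLE E.sigma (F ⊔ Bd))
    {Bdn : ∀ n, MeasurableSpace (En n).carrier} (hBdn : ∀ n, Bdn n ≤ (En n).sigma)
    (hBdna : ∀ n, ((En n).reparam f).IsAncillary (Bdn n))
    (hconv : FieldWeakConv En E (f η₀) Bdn Bd) (J : Finset Θ) {ε : ℝ} (hε : 0 < ε) :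
    ∃ (ξn : ∀ n, (En n).carrier → ℝ) (ξ : E.carrier → ℝ) (γ : Θ → ℝ → ℝ) (K : Θ → ℝ),
      (∀ n, Measurable[Bdn n] (ξn n)) ∧ Measurable[Bd] ξ ∧ VarWeakConv En E (f η₀) ξn ξ ∧
      (∀ h, Continuous (γ h)) ∧ (∀ h s, |γ h s| ≤ K h) ∧
      (∀ h ∈ J, ∫ x, |(E.restrict Bd hBd).lr (f η₀) h x - γ h (ξ x)|
        ∂((E.restrict Bd hBd).P (f η₀)) < ε) ∧
      ∀ᶠ n in atTop, ∀ h ∈ J, ∫ x, |((En n).restrict (Bdn n) (hBdn n)).lr (f η₀) h x -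
        γ h (ξn n x)| ∂(((En n).restrict (Bdn n) (hBdn n)).P (f η₀)) < ε := by
  classical
  have happrox := fun h => exists_integral_abs_sub_sum_rnDeriv_lt (m0 := E.sigma)
    (P := fun η => E.P (f η)) (fun η η' => hAC _ _) hF.1 hF.2 hFc.2 hBd hgen η₀
    (E.integrable_lr (f η₀) h) hε
  choose c hc using happrox
  -- A single variable encodes the events for all `h ∈ J`: the hypothesis treats one real variable
  -- at a time, while joint convergence is needed.
  obtain ⟨ξ, γ, hξ, hγ, hγ1, hγs⟩ := exists_measurable_encoding (m := Bd)
    (J.biUnion fun h => (c h).support)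
    (fun i : Υ × {s : Set E.carrier // MeasurableSet[Bd] s} => (i.2 : Set E.carrier))
    (fun i => i.2.2)
  obtain ⟨ξn, hξn, hw⟩ := hconv ξ hξ
  have hlim := fun h => hw.tendsto_integral_abs_lr_sub_sum hAC h (c h).support
    (fun i => f i.1) (c h) γ hγ hγ1
  have hlimit : ∀ h ∈ J, ∫ x, |E.lr (f η₀) h x - ∑ i ∈ (c h).support,
      c h i * (E.lr (f η₀) (f i.1) x * γ i (ξ x))| ∂(E.P (f η₀)) < ε := fun h hh => by
    refine lt_of_eq_of_lt (integral_congr_ae (Eventually.of_forall fun x => ?_)) (hc h)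
    simp only
    congr 2
    refine Finset.sum_congr rfl fun i hi => ?_
    rw [hγs i (Finset.mem_biUnion.2 ⟨h, hh, hi⟩)]
    rfl
  have hmass : ∀ θ, Tendsto (fun n => ∫ x, (En n).lr (f η₀) θ x ∂((En n).P (f η₀))) atTop (𝓝 1) :=
    fun θ => tendsto_integral_lr hAC (hw {θ}) (p := fun r => r.1 ⟨θ, Finset.mem_singleton_self θ⟩)
      ((continuous_apply _).comp continuous_fst) (fun _ _ => rfl) fun _ => rfl
  refine ⟨ξn, ξ, fun h s => ∑ i ∈ (c h).support, c h i * γ i s,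
    fun h => ∑ i ∈ (c h).support, |c h i|, hξn, hξ, hw,
    fun h => continuous_finsetSum _ fun i _ => continuous_const.mul (hγ i), fun h s => ?_,
    fun h hh => ?_, ?_⟩
  · refine (Finset.abs_sum_le_sum_abs _ _).trans (Finset.sum_le_sum fun i _ => ?_)
    rw [abs_mul]
    exact mul_le_of_le_one_right (abs_nonneg _) (hγ1 i s)
  · refine (E.integral_abs_lr_restrict_sub_sum_le f η₀ hBd hBda h (c h).support (fun i => i.1)
      (c h) (fun i x => γ i (ξ x)) (fun i => (hγ i).measurable.comp hξ)
      fun i x => hγ1 i _).trans_lt ?_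
    simpa [hAC.integral_lr] using hlimit h hh
  · rw [eventually_all_finset]
    intro h hh
    -- The singular masses in the projection bound vanish asymptotically.
    have hz : Tendsto (fun n => 2 * (1 - ∫ x, (En n).lr (f η₀) h x ∂((En n).P (f η₀))) +
        ∑ i ∈ (c h).support, |c h i| *
          (1 - ∫ x, (En n).lr (f η₀) (f i.1) x ∂((En n).P (f η₀)))) atTop (𝓝 0) := by
      have h1 := (((hmass h).const_sub 1).const_mul 2).add (tendsto_finsetSum (c h).support
        fun i _ => ((hmass (f i.1)).const_sub 1).const_mul |c h i|)
      simpa using h1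
    have h2 := (hlim h).add hz
    rw [add_zero] at h2
    filter_upwards [h2.eventually_lt_const (hlimit h hh)] with n hn
    refine ((En n).integral_abs_lr_restrict_sub_sum_le f η₀ (hBdn n) (hBdna n) h (c h).support
      (fun i => i.1) (c h) (fun i x => γ i (ξn n x)) (fun i => (hγ i).measurable.comp (hξn n))
      fun i x => hγ1 i _).trans_lt ?_
    rw [add_assoc]
    exact hn

end StatExperiment

/-! ### Convergence of the restricted experiments. -/

namespace StatExperiment

variable {Θ : Type w} {Υ : Type w'}

/-- The sup distance on `J → ℝ` is at most the sum of the coordinate distances, so coordinatewise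
`L¹` approximation suffices. -/
theorem integrable_dist_lr_restrict (E : StatExperiment.{w, u} Θ)
    {A : MeasurableSpace E.carrier} (hA : A ≤ E.sigma) (h₀ : Θ) (J : Finset Θ)
    {ξ : E.carrier → ℝ} (hξ : Measurable[A] ξ) {γ : Θ → ℝ → ℝ} {K : Θ → ℝ}
    (hγ : ∀ h, Continuous (γ h)) (hγK : ∀ h s, |γ h s| ≤ K h) :
    Integrable (fun x => dist (fun h : J => (E.restrict A hA).lr h₀ h x) fun h => γ h (ξ x))
        ((E.restrict A hA).P h₀) ∧
      ∫ x, dist (fun h : J => (E.restrict A hA).lr h₀ h x) (fun h => γ h (ξ x))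
          ∂((E.restrict A hA).P h₀) ≤
        ∑ h : J, ∫ x, |(E.restrict A hA).lr h₀ h x - γ h (ξ x)| ∂((E.restrict A hA).P h₀) := by
  have hγm : ∀ h, Measurable[A] fun x => γ h (ξ x) := fun h => (hγ h).measurable.comp hξ
  have hi : ∀ h : J, Integrable (fun x => |(E.restrict A hA).lr h₀ h x - γ h (ξ x)|)
      ((E.restrict A hA).P h₀) := fun h =>
    (((E.restrict A hA).integrable_lr h₀ h).sub (Integrable.of_bound
      (hγm h).aestronglyMeasurable (K h) (Eventually.of_forall fun x => hγK h _))).abs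
  have hd : ∀ x, dist (fun h : J => (E.restrict A hA).lr h₀ h x) (fun h => γ h (ξ x)) ≤
      ∑ h : J, |(E.restrict A hA).lr h₀ h x - γ h (ξ x)| := fun x => by
    refine (dist_pi_le_iff (Finset.sum_nonneg fun h _ => abs_nonneg _)).2 fun h => ?_
    exact Finset.single_le_sum (f := fun h : J => |(E.restrict A hA).lr h₀ h x - γ h (ξ x)|)
      (fun h _ => abs_nonneg _) (Finset.mem_univ h)
  have hdi : Integrable
      (fun x => dist (fun h : J => (E.restrict A hA).lr h₀ h x) fun h => γ h (ξ x))
      ((E.restrict A hA).P h₀) := by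
    refine (integrable_finsetSum Finset.univ fun h _ => hi h).mono' ?_
      (Eventually.of_forall fun x => ?_)
    · exact (((E.restrict A hA).measurable_lr_pi h₀ J).dist
        (measurable_pi_lambda _ fun h => hγm h)).aestronglyMeasurable
    · rw [Real.norm_of_nonneg dist_nonneg]
      exact hd x
  refine ⟨hdi, ?_⟩
  rw [← integral_finsetSum _ fun h _ => hi h]
  exact integral_mono hdi (integrable_finsetSum Finset.univ fun h _ => hi h) hd

variable {En : ℕ → StatExperiment.{w, u} Θ} {E : StatExperiment.{w, v} Θ}

/-- Weak convergence of variables measurable for sub-σ-fields gives convergence in distribution of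
their continuous functions in the restricted experiments. -/
theorem VarWeakConv.tendstoInDistribution_restrict {h₀ : Θ}
    {ξn : ∀ n, (En n).carrier → ℝ} {ξ : E.carrier → ℝ} (hw : VarWeakConv En E h₀ ξn ξ)
    {An : ∀ n, MeasurableSpace (En n).carrier} {A : MeasurableSpace E.carrier}
    (hAn : ∀ n, An n ≤ (En n).sigma) (hA : A ≤ E.sigma)
    (hξn : ∀ n, Measurable[An n] (ξn n)) (hξ : Measurable[A] ξ)
    {S : Type*} [PseudoEMetricSpace S] [MeasurableSpace S] [BorelSpace S]
    {γ : ℝ → S} (hγ : Continuous γ) :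
    TendstoInDistribution
      (fun n (x : ((En n).restrict (An n) (hAn n)).carrier) => γ (ξn n x)) atTop
      (fun (x : (E.restrict A hA).carrier) => γ (ξ x))
      (fun n => ((En n).restrict (An n) (hAn n)).P h₀) ((E.restrict A hA).P h₀) := by
  refine tendstoInDistribution_of_forall_lipschitz
    (fun n => (hγ.measurable.comp (hξn n)).aemeasurable) (hγ.measurable.comp hξ).aemeasurable
    fun g K L hK hL => ?_
  have hgγ : Measurable fun s => g (γ s) := (hL.continuous.comp hγ).measurable
  -- Only the marginal law of `ξₙ` matters, so the empty family of likelihood ratios is enough.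
  have h1 := (hw ∅).tendsto_integral (g := fun r => g (γ r.2))
    ((hL.continuous.comp hγ).comp continuous_snd) (fun r => hK _)
  have e : ∫ x, g (γ (ξ x)) ∂(E.P h₀) = ∫ x, g (γ (ξ x)) ∂((E.restrict A hA).P h₀) :=
    integral_trim hA (hgγ.comp hξ).stronglyMeasurable
  have en : ∀ n, ∫ x, g (γ (ξn n x)) ∂((En n).P h₀) =
      ∫ x, g (γ (ξn n x)) ∂(((En n).restrict (An n) (hAn n)).P h₀) := fun n =>
    integral_trim (hAn n) (hgγ.comp (hξn n)).stronglyMeasurable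
  simpa only [e, en] using h1

/-- Weak convergence of the restrictions to ancillary σ-fields of a subexperiment. -/
theorem weakConv_restrict_of_ancillary (f : Υ → Θ) (η₀ : Υ) (hAC : E.MutuallyAC)
    {F Bd : MeasurableSpace E.carrier} (hF : (E.reparam f).IsSufficient F)
    (hFc : (E.reparam f).IsBoundedlyComplete F) (hBd : Bd ≤ E.sigma)
    (hBda : (E.reparam f).IsAncillary Bd) (hgen : (E.reparam f).EssLE E.sigma (F ⊔ Bd))
    {Bdn : ∀ n, MeasurableSpace (En n).carrier} (hBdn : ∀ n, Bdn n ≤ (En n).sigma)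
    (hBdna : ∀ n, ((En n).reparam f).IsAncillary (Bdn n))
    (hconv : FieldWeakConv En E (f η₀) Bdn Bd) :
    WeakConv (fun n => (En n).restrict (Bdn n) (hBdn n)) (E.restrict Bd hBd) := by
  refine weakConv_of_base (hAC.restrict Bd hBd) (f η₀) fun J => ?_
  refine tendstoInDistribution_of_approx
    (fun n => (((En n).restrict (Bdn n) (hBdn n)).measurable_lr_pi (f η₀) J).aemeasurable)
    ((E.restrict Bd hBd).measurable_lr_pi (f η₀) J).aemeasurable fun ε hε => ?_
  -- The coordinate errors are summed over `J`; the `+ 1` covers empty `J`.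
  obtain ⟨ξn, ξ, γ, K, hξn, hξ, hw, hγ, hγK, hlim, happ⟩ :=
    exists_approx_lr_restrict f η₀ hAC hF hFc hBd hBda hgen hBdn hBdna hconv J
      (ε := ε / (J.card + 1)) (by positivity)
  have hsum : ∀ a : J → ℝ, (∀ h, a h < ε / (J.card + 1)) → ∑ h, a h ≤ ε := fun a ha => by
    refine (Finset.sum_le_card_nsmul _ _ _ fun h _ => (ha h).le).trans ?_
    rw [Finset.card_univ, Fintype.card_coe, nsmul_eq_mul, mul_div_assoc',
      div_le_iff₀ (by positivity)]
    nlinarith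
  refine ⟨fun n x h => γ h (ξn n x), fun x h => γ h (ξ x),
    hw.tendstoInDistribution_restrict hBdn hBd hξn hξ (γ := fun s (h : J) => γ h s)
      (continuous_pi fun h => hγ h), ?_, ?_⟩
  · filter_upwards [happ] with n hn
    obtain ⟨h1, h2⟩ := (En n).integrable_dist_lr_restrict (hBdn n) (f η₀) J (hξn n) hγ hγK
    exact ⟨h1, h2.trans (hsum _ fun h => hn h h.2)⟩
  · obtain ⟨h1, h2⟩ := E.integrable_dist_lr_restrict hBd (f η₀) J hξ hγ hγK
    exact ⟨h1, h2.trans (hsum _ fun h => hlim h h.2)⟩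

end StatExperiment

theorem mainTheorem4 {k : ℕ} {Υ : Type w} [AddCommGroup Υ] [Module ℝ Υ]
    (En : ℕ → StatExperiment.{w, u} (EuclideanSpace ℝ (Fin k) × Υ))
    (E : StatExperiment.{w, v} (EuclideanSpace ℝ (Fin k) × Υ))
    -- standing assumptions on the limit experiment
    (hAC : E.MutuallyAC) (hcg : E.EssCountablyGenerated)
    -- (i) the nuisance subexperiment of the limit experiment
    (F Bd : MeasurableSpace E.carrier)
    (hF_min : E.nuisance.IsMinimalSufficient F)
    (hF_compl : E.nuisance.IsBoundedlyComplete F)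
    (hBd_le : Bd ≤ E.sigma)
    (hBd_max : E.nuisance.IsMaximalAncillary Bd)
    (hBd_gen : E.nuisance.Generates F Bd)
    (hBd_unique : ∀ C : MeasurableSpace E.carrier, E.nuisance.IsMaximalAncillary C →
      E.nuisance.Generates F C → E.nuisance.EssEq C Bd)
    -- (ii) the nuisance subexperiments of the sequence
    (Fn Bdn : ∀ n, MeasurableSpace (En n).carrier)
    (hFn_min : ∀ n, (En n).nuisance.IsMinimalSufficient (Fn n))
    (hFn_compl : ∀ n, (En n).nuisance.IsBoundedlyComplete (Fn n))
    (hBdn_le : ∀ n, Bdn n ≤ (En n).sigma)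
    (hBdn_max : ∀ n, (En n).nuisance.IsMaximalAncillary (Bdn n))
    -- (iii) weak convergence of the maximal ancillary σ-fields
    (hconv : StatExperiment.FieldWeakConv En E 0 Bdn Bd) :
    StatExperiment.WeakConv (fun n => (En n).restrict (Bdn n) (hBdn_le n))
      (E.restrict Bd hBd_le) :=
  StatExperiment.weakConv_restrict_of_ancillary (fun η => (0, η)) 0 hAC hF_min.1 hF_compl hBd_le
    hBd_max.1 hBd_gen.2 hBdn_le (fun n => (hBdn_max n).1) hconv
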